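/- Let $H\in(0,1)$ and $K\in(0,2)$ with $0<HK<1$, let $W=\{W_\theta,\theta\ge 0\}$ be a standard Brownian motion on a probability space $(\Omega,\mathcal F,\mathbb P)$, and let $X^{H,K}=\{X^{H,K}_t, t\ge 0\}$ be the Lei–Nualart process $$X^{H,K}_0=0,\qquad X^{H,K}_t=\int_0^\infty \bigl(1-e^{-\theta t^{2H}}\bigr)\,\theta^{-\frac{1+K}{2}}\,dW_\theta \quad\text{a.s. for every } t>0 ,$$ where the integral is the Wiener integral and where $X^{H,K}$ is any version that is jointly measurable in $(t,\omega)$ on $(0,1)\times\Omega$, up to a null set of $dt\otimes\mathbb P$ (for instance any version with almost surely continuous paths). Then almost surely the path $t\mapsto X^{H,K}_t$ belongs to the Besov–Orlicz space $\mathcal B^{HK}_{\Phi_2,\infty}(0,1)$. Here $\Phi_2(x)=e^{x^2}-1$. For a measurable set $A\subseteq\mathbb R$ put $\|f\|_{L^{\Phi_2}(A)}:=\sup_{p\ge 1}p^{-1/2}\|f\|_{L^p(A)}$, the supremum being over real $p\ge1$. With $I=(0,1)$ and $I(h)=\{s\in I: s+h\in I\}$, the space $\mathcal B^{\alpha}_{\Phi_2,\infty}(0,1)$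 consists of all measurable functions $f$ on $I$ such that $\|f\|_{L^{\Phi_2}(I)}<\infty$ and $$\sup_{0<t\le 1}\ t^{-\alpha}\sup_{|h|\le t}\bigl\|f(\cdot+h)-f(\cdot)\bigr\|_{L^{\Phi_2}(I(h))}<\infty .$$ -/

import Mathlib

open MeasureTheory ProbabilityTheory Set Filter Topology
open scoped NNReal ENNReal

noncomputable section

namespace BesovOrlicz

/-- `I(h) = {s ∈ I : s + h ∈ I}`, where `I = (0, 1)`. -/
def incrementDomain (h : ℝ) : Set ℝ :=
  {s | s ∈ Ioo (0 : ℝ) 1 ∧ s + h ∈ Ioo (0 : ℝ) 1}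

/-- The norm `sup_{p ≥ 1} p^{-1/β} ‖f‖_{L^p(A)}` (over real `p`) of the exponential Orlicz space
`L^{Φ_β}(A)`, `Φ_β(x) = exp(x^β) - 1`, with values in `[0, ∞]`. -/
def expOrliczNorm (β : ℝ) (A : Set ℝ) (f : ℝ → ℝ) : ℝ≥0∞ :=
  ⨆ p ∈ Ici (1 : ℝ),
    ENNReal.ofReal (p ^ (-1 / β)) * eLpNorm f (ENNReal.ofReal p) (volume.restrict A)

/-- The modulus of smoothness `sup_{|h| ≤ t} ‖f(· + h) - f‖_{L^{Φ_β}(I(h))}`. -/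
def modulus (β : ℝ) (f : ℝ → ℝ) (t : ℝ) : ℝ≥0∞ :=
  ⨆ h ∈ {h : ℝ | |h| ≤ t}, expOrliczNorm β (incrementDomain h) (fun s => f (s + h) - f s)

/-- The seminorm `sup_{0 < t ≤ 1} t^{-α} ω(f, t)`, `ω` being the modulus of smoothness. -/
def seminorm (α β : ℝ) (f : ℝ → ℝ) : ℝ≥0∞ :=
  ⨆ t ∈ Ioc (0 : ℝ) 1, ENNReal.ofReal (t ^ (-α)) * modulus β f t

/-- The Besov-Orlicz space of order `α` over `L^{Φ_β}(I)`, with third index `∞`, on `I = (0, 1)`.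
Functions on `I` are represented by functions on `ℝ`, whose values outside `I` play no role. -/
def space (α β : ℝ) : Set (ℝ → ℝ) :=
  {f | AEStronglyMeasurable f (volume.restrict (Ioo (0 : ℝ) 1)) ∧
    expOrliczNorm β (Ioo (0 : ℝ) 1) f < ∞ ∧ seminorm α β f < ∞}

end BesovOrlicz

namespace WienerIntegral

/-- A step function `∑ i, c i * 1_{(a i, b i]}` on `[0, ∞)`. -/
structure StepFunction where
  n : ℕ
  c : Fin n → ℝ
  a : Fin n → ℝ≥0
  b : Fin n → ℝ≥0
  le : ∀ i, a i ≤ b i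

/-- The values of a step function. -/
def StepFunction.eval (φ : StepFunction) (θ : ℝ) : ℝ :=
  ∑ i, φ.c i * (Ioc (φ.a i : ℝ) (φ.b i : ℝ)).indicator (fun _ => (1 : ℝ)) θ

/-- The integral `∑ i, c i * (W (b i) - W (a i))` of a step function with respect to `W`. -/
def StepFunction.integral {Ω : Type*} (φ : StepFunction) (W : ℝ≥0 → Ω → ℝ) (ω : Ω) : ℝ :=
  ∑ i, φ.c i * (W (φ.b i) ω - W (φ.a i) ω)

/-- `Y` is (a representative of) the Wiener integral `∫_0^∞ f(θ) dW_θ`: `f ∈ L²(0, ∞)`, and `Y` is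
the limit in `L²(P)` of the integrals of step functions that converge to `f` in `L²(0, ∞)`.
When `W` is a Brownian motion, the limit does not depend on the sequence, by the isometry. -/
def IsWienerIntegral {Ω : Type*} [MeasurableSpace Ω] (W : ℝ≥0 → Ω → ℝ) (P : Measure Ω)
    (f : ℝ → ℝ) (Y : Ω → ℝ) : Prop :=
  MemLp f 2 (volume.restrict (Ioi (0 : ℝ))) ∧ MemLp Y 2 P ∧
  ∃ φ : ℕ → StepFunction,
    Tendsto (fun n => eLpNorm (fun θ => (φ n).eval θ - f θ) 2 (volume.restrict (Ioi (0 : ℝ))))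
      atTop (𝓝 0) ∧
    Tendsto (fun n => eLpNorm (fun ω => (φ n).integral W ω - Y ω) 2 P) atTop (𝓝 0)

end WienerIntegral

/-- `X` is a Lei-Nualart process with parameters `H, K`, driven by `W`: almost surely `X_0 = 0`, and
`X_t = ∫_0^∞ (1 - exp(-θ t^{2H})) θ^{-(1+K)/2} dW_θ` almost surely, for every `t > 0`. -/
structure IsLeiNualart {Ω : Type*} [MeasurableSpace Ω] (H K : ℝ) (W : ℝ≥0 → Ω → ℝ)
    (P : Measure Ω) (X : ℝ≥0 → Ω → ℝ) : Prop where
  zero : ∀ᵐ ω ∂P, X 0 ω = 0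
  integral : ∀ t : ℝ≥0, 0 < t → WienerIntegral.IsWienerIntegral W P
    (fun θ => (1 - Real.exp (-θ * (t : ℝ) ^ (2 * H))) * θ ^ (-(1 + K) / 2)) (X t)

end

/-! Integration by parts turns the Wiener integral into a pathwise one: almost surely `X_t = ∫
γ_τ(θ) B_θ dθ` with `τ = t^{2H}` and `γ_τ` minus the `θ`-derivative of the integrand
(`ae_eq_integral`). This rests on an isometry: `B_s` and the indicators of `(0, s]` in `L²(0, ∞)`
have the same covariance `min s t`.

All randomness is then controlled by one variable, `A = ∫ θ^{-1-K/2} min(θ, 1) exp(B_θ² / (4θ)) dθ`,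
which is almost surely finite because `B_θ / √θ` is standard Gaussian. Splitting at a level `L` of
order `√log(1/τ)` gives, with a random constant, a size bound `τ^{K/2} (1 + √log(1/τ))` and an
increment bound `(τ - σ) σ^{K/2-1} (1 + √log(1/σ))` (`exists_leiNualart_path_bounds`).

With `α = HK`, the increment over `[s, s + h]` is thus at most a constant times `h^α (1 + √log(1/h))
min(1, (s/h)^{α-1})` (`abs_increment_le`). The logarithm is harmless because the last factor is
concentrated near `s ≲ h`: for large `p` its `L^p` norm is at most `(2h)^{1/p}`, and `√log(1/h)
h^{1/p} ≤ √p`, exactly the growth that `Φ₂` allows (`rpow_mul_one_add_sqrt_log_mul_rpow_le`). -/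

/-! ### A jointly measurable version of the driving process -/

theorem exists_measurable_modification {Ω : Type*} [MeasurableSpace Ω] {P : Measure Ω}
    {W : ℝ≥0 → Ω → ℝ} (hm : ∀ t, AEMeasurable (W t) P) (hc : ∀ᵐ ω ∂P, Continuous (W · ω)) :
    ∃ B : ℝ≥0 → Ω → ℝ, Measurable (Function.uncurry B) ∧ ∀ᵐ ω ∂P, ∀ t, W t ω = B t ω := by
  classical
  let u := TopologicalSpace.denseSeq ℝ≥0
  have hu : ∀ᵐ ω ∂P, ∀ n, W (u n) ω = (hm (u n)).mk _ ω :=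
    ae_all_iff.2 fun n => (hm (u n)).ae_eq_mk
  -- Off the measurable null set `N` the paths are continuous and agree on a countable dense set
  -- with measurable representatives. Setting the process to zero on `N` therefore gives continuous
  -- paths and measurable marginals.
  obtain ⟨N, hN, hNm, hN0⟩ := exists_measurable_superset_of_null (ae_iff.1 (hc.and hu))
  have hgood : ∀ ω ∈ Nᶜ, Continuous (W · ω) ∧ ∀ n, W (u n) ω = (hm (u n)).mk _ ω := by
    intro ω hω
    by_contra h
    exact hω (hN h)
  refine ⟨fun t => (Nᶜ).indicator (W t), ?_, ?_⟩
  · apply measurable_uncurry_of_continuous_of_measurable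
    · intro ω
      by_cases hω : ω ∈ Nᶜ
      · simpa [hω] using (hgood ω hω).1
      · simp only [indicator_of_notMem hω]
        exact continuous_const
    · intro t
      have ht : t ∈ closure (range u) := by
        rw [(TopologicalSpace.denseRange_denseSeq ℝ≥0).closure_range]; trivial
      obtain ⟨x, hx, hxt⟩ := mem_closure_iff_seq_limit.1 ht
      choose k hk using hx
      refine measurable_of_tendsto_metrizable
        (f := fun n => (Nᶜ).indicator ((hm (u (k n))).mk _))
        (fun n => (hm (u (k n))).measurable_mk.indicator hNm.compl) ?_
      rw [tendsto_pi_nhds]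
      intro ω
      by_cases hω : ω ∈ Nᶜ
      · simp only [indicator_of_mem hω]
        simp_rw [← (hgood ω hω).2, hk]
        exact ((hgood ω hω).1.tendsto t).comp hxt
      · simp only [indicator_of_notMem hω]
        exact tendsto_const_nhds
  · filter_upwards [measure_eq_zero_iff_ae_notMem.1 hN0] with ω hω t
    exact (indicator_of_mem (s := Nᶜ) hω _).symm

/-! ### Isometries from equality of covariances -/

theorem integrable_mul_and_integral_abs_mul_le {Ω : Type*} [MeasurableSpace Ω] {Q : Measure Ω}
    {f g : Ω → ℝ} (hf : MemLp f 2 Q) (hg : MemLp g 2 Q) :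
    Integrable (fun ω => f ω * g ω) Q ∧
      ∫ ω, |f ω * g ω| ∂Q ≤ √(∫ ω, f ω ^ 2 ∂Q) * √(∫ ω, g ω ^ 2 ∂Q) := by
  refine ⟨hf.integrable_mul hg, ?_⟩
  have h := integral_mul_norm_le_Lp_mul_Lq (μ := Q) (f := f) (g := g)
    Real.HolderConjugate.two_two (by simpa using hf) (by simpa using hg)
  simp only [Real.norm_eq_abs] at h
  simp only [abs_mul, Real.sqrt_eq_rpow]
  simpa using h

/-- The square of the integral is a double integral over `T × T`. Fubini applies since
Cauchy–Schwarz dominates the absolute moments by a product of two copies of `hint`. -/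
theorem integral_sq_integral_mul {T Ω : Type*} [MeasurableSpace T] [MeasurableSpace Ω]
    {μ : Measure T} [SFinite μ] {Q : Measure Ω} [SFinite Q] {V : T → Ω → ℝ} {γ : T → ℝ}
    (hV : Measurable (Function.uncurry V)) (hL2 : ∀ t, MemLp (V t) 2 Q) (hγ : Measurable γ)
    (hint : Integrable (fun t => γ t * √(∫ ω, V t ω ^ 2 ∂Q)) μ) :
    Integrable (fun ω => (∫ t, γ t * V t ω ∂μ) ^ 2) Q ∧
      ∫ ω, (∫ t, γ t * V t ω ∂μ) ^ 2 ∂Q =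
        ∫ z : T × T, γ z.1 * γ z.2 * ∫ ω, V z.1 ω * V z.2 ω ∂Q ∂(μ.prod μ) := by
  let F : T × T → Ω → ℝ := fun z ω => (γ z.1 * V z.1 ω) * (γ z.2 * V z.2 ω)
  have hm1 : Measurable fun p : (T × T) × Ω => V p.1.1 p.2 :=
    hV.comp ((measurable_fst.comp measurable_fst).prodMk measurable_snd)
  have hm2 : Measurable fun p : (T × T) × Ω => V p.1.2 p.2 :=
    hV.comp ((measurable_snd.comp measurable_fst).prodMk measurable_snd)
  have hFm : Measurable (Function.uncurry F) :=
    ((hγ.comp (measurable_fst.comp measurable_fst)).mul hm1).mul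
      ((hγ.comp (measurable_snd.comp measurable_fst)).mul hm2)
  have hFeq : ∀ z ω, F z ω = (γ z.1 * γ z.2) * (V z.1 ω * V z.2 ω) := fun z ω => by
    simp only [F]; ring
  have hFint : Integrable (Function.uncurry F) ((μ.prod μ).prod Q) := by
    rw [integrable_prod_iff hFm.aestronglyMeasurable]
    refine ⟨ae_of_all _ fun z => ?_, ?_⟩
    · simp only [Function.uncurry, hFeq]
      exact (integrable_mul_and_integral_abs_mul_le (hL2 z.1) (hL2 z.2)).1.const_mul _
    · refine (hint.mul_prod hint).norm.mono'
        hFm.norm.stronglyMeasurable.integral_prod_right'.aestronglyMeasurable (ae_of_all _ fun z => ?_)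
      simp only [Function.uncurry, hFeq, Real.norm_eq_abs]
      simp only [abs_mul (γ z.1 * γ z.2)]
      rw [integral_const_mul, abs_mul, abs_abs, abs_of_nonneg (integral_nonneg fun _ => abs_nonneg _)]
      refine (mul_le_mul_of_nonneg_left
        (integrable_mul_and_integral_abs_mul_le (hL2 z.1) (hL2 z.2)).2 (abs_nonneg _)).trans_eq ?_
      rw [abs_mul, abs_mul, abs_mul, abs_mul, abs_of_nonneg (Real.sqrt_nonneg _),
        abs_of_nonneg (Real.sqrt_nonneg _)]
      ring
  have hsq : ∀ ω, (∫ t, γ t * V t ω ∂μ) ^ 2 = ∫ z, F z ω ∂(μ.prod μ) := fun ω => by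
    rw [sq, ← integral_prod_mul]
  simp only [hsq]
  refine ⟨hFint.integral_prod_right, ?_⟩
  rw [← integral_integral_swap hFint]
  simp only [hFeq, integral_const_mul]

theorem eLpNorm_two_eq_ofReal_sqrt {Ω : Type*} [MeasurableSpace Ω] {Q : Measure Ω} {f : Ω → ℝ}
    (hf : Integrable (fun ω => f ω ^ 2) Q) :
    eLpNorm f 2 Q = ENNReal.ofReal √(∫ ω, f ω ^ 2 ∂Q) := by
  rw [eLpNorm_eq_lintegral_rpow_enorm_toReal two_ne_zero ENNReal.ofNat_ne_top,
    Real.sqrt_eq_rpow, ← ENNReal.ofReal_rpow_of_nonneg (integral_nonneg fun _ => sq_nonneg _)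
      (by norm_num), ofReal_integral_eq_lintegral_ofReal hf (ae_of_all _ fun _ => sq_nonneg _)]
  congr 2
  funext ω
  rw [← ofReal_norm, ENNReal.toReal_ofNat, ENNReal.rpow_ofNat,
    ← ENNReal.ofReal_pow (norm_nonneg _), Real.norm_eq_abs, sq_abs]

/-- The `L²` norm of a Wiener-type integral depends on the covariance kernel only. -/
theorem eLpNorm_integral_mul_eq {T Ω Ω' : Type*} [MeasurableSpace T] [MeasurableSpace Ω]
    [MeasurableSpace Ω'] {μ : Measure T} [SFinite μ] {Q : Measure Ω} [SFinite Q]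
    {Q' : Measure Ω'} [SFinite Q'] {V : T → Ω → ℝ} {V' : T → Ω' → ℝ} {γ : T → ℝ}
    (hV : Measurable (Function.uncurry V)) (hL2 : ∀ t, MemLp (V t) 2 Q)
    (hV' : Measurable (Function.uncurry V')) (hL2' : ∀ t, MemLp (V' t) 2 Q')
    (hcov : ∀ s t, ∫ ω, V s ω * V t ω ∂Q = ∫ ω, V' s ω * V' t ω ∂Q') (hγ : Measurable γ)
    (hint : Integrable (fun t => γ t * √(∫ ω, V t ω ^ 2 ∂Q)) μ) :
    eLpNorm (fun ω => ∫ t, γ t * V t ω ∂μ) 2 Q = eLpNorm (fun ω => ∫ t, γ t * V' t ω ∂μ) 2 Q' := by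
  have hint' : Integrable (fun t => γ t * √(∫ ω, V' t ω ^ 2 ∂Q')) μ := by
    refine hint.congr (ae_of_all _ fun t => ?_)
    have := hcov t t
    simp only [← sq] at this
    simp only [this]
  obtain ⟨h1, h2⟩ := integral_sq_integral_mul hV hL2 hγ hint
  obtain ⟨h1', h2'⟩ := integral_sq_integral_mul hV' hL2' hγ hint'
  rw [eLpNorm_two_eq_ofReal_sqrt h1, eLpNorm_two_eq_ofReal_sqrt h1', h2, h2']
  simp only [hcov]

theorem measurableEmbedding_inl {α β : Type*} [MeasurableSpace α] [MeasurableSpace β] :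
    MeasurableEmbedding (Sum.inl : α → α ⊕ β) where
  injective := Sum.inl_injective
  measurable := measurable_inl
  measurableSet_image' := fun _ hs => measurableSet_inl_image.2 hs

theorem measurableEmbedding_inr {α β : Type*} [MeasurableSpace α] [MeasurableSpace β] :
    MeasurableEmbedding (Sum.inr : β → α ⊕ β) where
  injective := Sum.inr_injective
  measurable := measurable_inr
  measurableSet_image' := fun _ hs => measurableSet_inr_image.2 hs

theorem integral_map_inl_count_add_map_inr {J T : Type*} [Fintype J] [MeasurableSpace J]
    [MeasurableSingletonClass J] [MeasurableSpace T] {μ : Measure T} {f : J ⊕ T → ℝ}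
    (hf : Integrable (fun t => f (Sum.inr t)) μ) :
    Integrable f (Measure.count.map Sum.inl + μ.map Sum.inr) ∧
    ∫ x, f x ∂(Measure.count.map Sum.inl + μ.map Sum.inr) =
      ∑ j, f (Sum.inl j) + ∫ t, f (Sum.inr t) ∂μ := by
  have h1 : Integrable f (Measure.count.map Sum.inl) :=
    (measurableEmbedding_inl.integrable_map_iff).2 Integrable.of_finite
  have h2 : Integrable f (μ.map Sum.inr) := (measurableEmbedding_inr.integrable_map_iff).2 hf
  refine ⟨h1.add_measure h2, ?_⟩
  rw [integral_add_measure h1 h2, measurableEmbedding_inl.integral_map,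
    measurableEmbedding_inr.integral_map, integral_count]

/-- A finite sum minus an integral is a single integral over `J ⊕ T` against counting measure plus
`μ`, so the isometry for plain integrals applies. -/
theorem eLpNorm_sum_sub_integral_eq {J T Ω Ω' : Type*} [Fintype J] [MeasurableSpace J]
    [MeasurableSingletonClass J] [MeasurableSpace T] [MeasurableSpace Ω]
    [MeasurableSpace Ω'] {μ : Measure T} [SFinite μ] {Q : Measure Ω} [SFinite Q]
    {Q' : Measure Ω'} [SFinite Q'] {V : T → Ω → ℝ} {V' : T → Ω' → ℝ} {γ : T → ℝ}
    (hV : Measurable (Function.uncurry V)) (hL2 : ∀ t, MemLp (V t) 2 Q)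
    (hV' : Measurable (Function.uncurry V')) (hL2' : ∀ t, MemLp (V' t) 2 Q')
    (hcov : ∀ s t, ∫ ω, V s ω * V t ω ∂Q = ∫ ω, V' s ω * V' t ω ∂Q') (hγ : Measurable γ)
    (hint : Integrable (fun t => γ t * √(∫ ω, V t ω ^ 2 ∂Q)) μ)
    (hae : ∀ᵐ ω ∂Q, Integrable (fun t => γ t * V t ω) μ)
    (hae' : ∀ᵐ ω ∂Q', Integrable (fun t => γ t * V' t ω) μ) (d : J → ℝ) (e : J → T) :
    eLpNorm (fun ω => ∑ j, d j * V (e j) ω - ∫ t, γ t * V t ω ∂μ) 2 Q =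
      eLpNorm (fun ω => ∑ j, d j * V' (e j) ω - ∫ t, γ t * V' t ω ∂μ) 2 Q' := by
  let δ : J ⊕ T → ℝ := Sum.elim d (fun t => -γ t)
  let ε : J ⊕ T → T := Sum.elim e id
  let ν : Measure (J ⊕ T) := Measure.count.map Sum.inl + μ.map Sum.inr
  have hδ : Measurable δ := (measurable_of_countable d).sumElim hγ.neg
  have hε : Measurable ε := (measurable_of_countable e).sumElim measurable_id
  have hεV : Measurable (Function.uncurry fun x => V (ε x)) :=
    hV.comp ((hε.comp measurable_fst).prodMk measurable_snd)
  have hεV' : Measurable (Function.uncurry fun x => V' (ε x)) :=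
    hV'.comp ((hε.comp measurable_fst).prodMk measurable_snd)
  have h1 : ∀ᵐ ω ∂Q, ∑ j, d j * V (e j) ω - ∫ t, γ t * V t ω ∂μ = ∫ x, δ x * V (ε x) ω ∂ν := by
    filter_upwards [hae] with ω hω
    rw [(integral_map_inl_count_add_map_inr (by simpa [δ, ε] using hω.neg)).2]
    simp [δ, ε, integral_neg, sub_eq_add_neg]
  have h2 : ∀ᵐ ω ∂Q', ∑ j, d j * V' (e j) ω - ∫ t, γ t * V' t ω ∂μ = ∫ x, δ x * V' (ε x) ω ∂ν := by
    filter_upwards [hae'] with ω hω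
    rw [(integral_map_inl_count_add_map_inr (by simpa [δ, ε] using hω.neg)).2]
    simp [δ, ε, integral_neg, sub_eq_add_neg]
  rw [eLpNorm_congr_ae h1, eLpNorm_congr_ae h2]
  have : SFinite ν := by simp only [ν]; infer_instance
  exact eLpNorm_integral_mul_eq hεV (fun x => hL2 _) hεV' (fun x => hL2' _)
    (fun s t => hcov _ _) hδ (integral_map_inl_count_add_map_inr (by simpa [δ, ε] using hint.neg)).1

/-! ### Integration by parts for the Wiener integral -/

section BrownianMotion

variable {Ω : Type*} [MeasurableSpace Ω] {P : Measure Ω} {B : ℝ≥0 → Ω → ℝ}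

theorem ProbabilityTheory.IsPreBrownianReal.memLp_two (hB : IsPreBrownianReal B P) (t : ℝ≥0) :
    MemLp (B t) 2 P :=
  (hB.isGaussianProcess.hasGaussianLaw_eval t).memLp_two

theorem ProbabilityTheory.IsPreBrownianReal.integral_mul (hB : IsPreBrownianReal B P) (s t : ℝ≥0) :
    ∫ ω, B s ω * B t ω ∂P = (min s t : ℝ≥0) := by
  have : IsProbabilityMeasure P := hB.isGaussianProcess.isProbabilityMeasure
  have h := hB.covariance_eval s t
  rw [covariance_eq_sub (hB.memLp_two s) (hB.memLp_two t), hB.integral_eval, zero_mul,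
    sub_zero] at h
  simpa using h

theorem ProbabilityTheory.IsPreBrownianReal.integral_sq (hB : IsPreBrownianReal B P) (t : ℝ≥0) :
    ∫ ω, B t ω ^ 2 ∂P = t := by
  simp only [sq, hB.integral_mul, min_self]

/-- Fubini, with `E|B_θ| ≤ √θ` from Cauchy–Schwarz. -/
theorem ProbabilityTheory.IsPreBrownianReal.ae_integrable_mul (hB : IsPreBrownianReal B P)
    (hBm : Measurable (Function.uncurry B)) {γ : ℝ → ℝ} (hγ : Measurable γ)
    (hint : IntegrableOn (fun θ => γ θ * √θ) (Ioi 0)) :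
    ∀ᵐ ω ∂P, IntegrableOn (fun θ => γ θ * B θ.toNNReal ω) (Ioi 0) := by
  have : IsProbabilityMeasure P := hB.isGaussianProcess.isProbabilityMeasure
  have hm : Measurable (Function.uncurry fun (θ : ℝ) ω => γ θ * B θ.toNNReal ω) :=
    (hγ.comp measurable_fst).mul
      (hBm.comp ((measurable_real_toNNReal.comp measurable_fst).prodMk measurable_snd))
  refine Integrable.prod_left_ae (f := Function.uncurry fun (θ : ℝ) ω => γ θ * B θ.toNNReal ω) ?_
  rw [integrable_prod_iff hm.aestronglyMeasurable]
  refine ⟨ae_of_all _ fun θ => (hB.integrable_eval θ.toNNReal).const_mul (γ θ), ?_⟩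
  refine hint.norm.mono' hm.norm.stronglyMeasurable.integral_prod_right'.aestronglyMeasurable ?_
  filter_upwards [ae_restrict_mem measurableSet_Ioi] with θ hθ
  rw [Real.norm_of_nonneg (integral_nonneg fun _ => norm_nonneg _)]
  simp only [Function.uncurry, Real.norm_eq_abs, abs_mul, integral_const_mul]
  refine mul_le_mul_of_nonneg_left ?_ (abs_nonneg _)
  have h := (integrable_mul_and_integral_abs_mul_le (hB.memLp_two θ.toNNReal)
    (memLp_const (1 : ℝ))).2
  rw [hB.integral_sq, Real.coe_toNNReal _ (le_of_lt hθ)] at h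
  simpa [abs_of_nonneg (Real.sqrt_nonneg θ)] using h

/-- These indicators are the deterministic model with the Brownian covariance. -/
theorem integral_indicator_Ioc_mul_indicator_Ioc (s t : ℝ) :
    ∫ r in Ioi (0 : ℝ), (Ioc 0 s).indicator (fun _ => (1 : ℝ)) r *
      (Ioc 0 t).indicator (fun _ => 1) r = (min s.toNNReal t.toNNReal : ℝ≥0) := by
  have : ∀ r, (Ioc 0 s).indicator (fun _ => (1 : ℝ)) r * (Ioc 0 t).indicator (fun _ => 1) r =
      (Ioc 0 (min s t)).indicator (fun _ => (1 : ℝ)) r := fun r => by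
    simp only [indicator, mem_Ioc, le_min_iff]
    split_ifs <;> grind
  simp only [this]
  rw [integral_indicator measurableSet_Ioc, Measure.restrict_restrict measurableSet_Ioc,
    inter_eq_left.2 fun x hx => hx.1]
  simp [Real.coe_toNNReal', max_min_distrib_right]

theorem measurable_indicator_Ioc :
    Measurable (Function.uncurry fun t r : ℝ => (Ioc 0 t).indicator (fun _ => (1 : ℝ)) r) := by
  have : (Function.uncurry fun t r : ℝ => (Ioc 0 t).indicator (fun _ => (1 : ℝ)) r) =
      {p : ℝ × ℝ | 0 < p.2 ∧ p.2 ≤ p.1}.indicator fun _ => 1 := by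
    funext p
    simp [Function.uncurry, indicator]
  rw [this]
  exact measurable_const.indicator ((measurableSet_lt measurable_const measurable_snd).inter
    (measurableSet_le measurable_snd measurable_fst))

/-- Each interval is a difference of two intervals starting at `0`; the Boolean selects the
endpoint, `true` being the right one. -/
theorem WienerIntegral.StepFunction.eval_eq_sum (φ : StepFunction) (r : ℝ) (hr : 0 < r) :
    φ.eval r = ∑ j : Fin φ.n × Bool, (if j.2 then φ.c j.1 else -φ.c j.1) *
      (Ioc 0 ((if j.2 then φ.b j.1 else φ.a j.1 : ℝ≥0) : ℝ)).indicator (fun _ => (1 : ℝ)) r := by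
  rw [Fintype.sum_prod_type, eval]
  refine Finset.sum_congr rfl fun i _ => ?_
  have := φ.le i
  have h : (φ.a i : ℝ) ≤ φ.b i := by exact_mod_cast this
  simp only [Fintype.sum_bool, if_true, Bool.false_eq_true, if_false, neg_mul, indicator, mem_Ioc]
  split_ifs <;> grind

theorem WienerIntegral.StepFunction.integral_eq_sum {Ω : Type*} {B : ℝ≥0 → Ω → ℝ}
    (φ : StepFunction) (ω : Ω) :
    φ.integral B ω = ∑ j : Fin φ.n × Bool, (if j.2 then φ.c j.1 else -φ.c j.1) *
      B (if j.2 then φ.b j.1 else φ.a j.1) ω := by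
  rw [Fintype.sum_prod_type, integral]
  refine Finset.sum_congr rfl fun i _ => ?_
  simp only [Fintype.sum_bool, if_true, Bool.false_eq_true, if_false]
  ring

/-- The isometry behind integration by parts for the Wiener integral. -/
theorem ProbabilityTheory.IsPreBrownianReal.eLpNorm_integral_sub (hB : IsPreBrownianReal B P)
    (hBm : Measurable (Function.uncurry B)) {γ f : ℝ → ℝ} (hγ : Measurable γ)
    (hint : IntegrableOn (fun θ => γ θ * √θ) (Ioi 0))
    (hγint : ∀ r > 0, IntegrableOn γ (Ioi r)) (hf : ∀ r > 0, f r = ∫ θ in Ioi r, γ θ)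
    (φ : WienerIntegral.StepFunction) :
    eLpNorm (fun ω => φ.integral B ω - ∫ θ in Ioi (0 : ℝ), γ θ * B θ.toNNReal ω) 2 P =
      eLpNorm (fun r => φ.eval r - f r) 2 (volume.restrict (Ioi 0)) := by
  have : IsProbabilityMeasure P := hB.isGaussianProcess.isProbabilityMeasure
  have key : ∀ r : ℝ, 0 < r → ∀ θ ∈ Ioi (0 : ℝ), γ θ * (Ioc 0 θ).indicator (fun _ => (1 : ℝ)) r =
      (Ici r).indicator γ θ := by
    intro r hr θ _
    simp only [indicator, mem_Ioc, mem_Ici, hr, true_and]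
    split_ifs <;> simp
  have hsub : ∀ r : ℝ, 0 < r → Ioi (0 : ℝ) ∩ Ici r = Ici r := fun r hr =>
    inter_eq_right.2 fun x hx => lt_of_lt_of_le hr hx
  -- In the indicator model, integrating `γ θ` against the indicator of `(0, θ]` at `r` leaves the
  -- integral of `γ` beyond `r`, which is `f r`.
  have h := eLpNorm_sum_sub_integral_eq (μ := volume.restrict (Ioi (0 : ℝ))) (Q := P)
    (Q' := volume.restrict (Ioi (0 : ℝ))) (V := fun (θ : ℝ) ω => B θ.toNNReal ω)
    (V' := fun θ r => (Ioc 0 θ).indicator (fun _ => (1 : ℝ)) r)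
    (hBm.comp ((measurable_real_toNNReal.comp measurable_fst).prodMk measurable_snd))
    (fun θ => hB.memLp_two _) measurable_indicator_Ioc ?_ ?_ hγ ?_ (hB.ae_integrable_mul hBm hγ hint)
    ?_ (fun j : Fin φ.n × Bool => if j.2 then φ.c j.1 else -φ.c j.1)
    (fun j => ((if j.2 then φ.b j.1 else φ.a j.1 : ℝ≥0) : ℝ))
  · simp only [Real.toNNReal_coe] at h
    simp only [φ.integral_eq_sum]
    rw [h]
    refine eLpNorm_congr_ae ?_
    filter_upwards [ae_restrict_mem measurableSet_Ioi] with r hr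
    rw [φ.eval_eq_sum r hr, hf r hr, setIntegral_congr_fun measurableSet_Ioi (key r hr),
      setIntegral_indicator measurableSet_Ici, hsub r hr, integral_Ici_eq_integral_Ioi]
  · intro θ
    refine (memLp_indicator_const 2 measurableSet_Ioc (1 : ℝ) (Or.inr ?_)).mono_measure
      Measure.restrict_le_self
    simp
  · intro s t
    rw [integral_indicator_Ioc_mul_indicator_Ioc, hB.integral_mul]
  · refine (integrable_congr ?_).1 hint
    filter_upwards [ae_restrict_mem measurableSet_Ioi] with θ hθ
    rw [hB.integral_sq, Real.coe_toNNReal _ (le_of_lt hθ)]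
  · filter_upwards [ae_restrict_mem measurableSet_Ioi] with r hr
    refine (integrableOn_congr_fun (key r hr) measurableSet_Ioi).2 ?_
    refine Integrable.integrableOn ((integrable_indicator_iff measurableSet_Ici).2 ?_)
    exact (integrableOn_Ici_iff_integrableOn_Ioi (by simp)).2 (hγint r hr)

/-- Integration by parts for the Wiener integral. -/
theorem WienerIntegral.IsWienerIntegral.ae_eq_integral (hB : IsPreBrownianReal B P)
    (hBm : Measurable (Function.uncurry B)) {W : ℝ≥0 → Ω → ℝ} (hWB : ∀ᵐ ω ∂P, ∀ t, W t ω = B t ω)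
    {γ f : ℝ → ℝ} (hγ : Measurable γ) (hint : IntegrableOn (fun θ => γ θ * √θ) (Ioi 0))
    (hγint : ∀ r > 0, IntegrableOn γ (Ioi r)) (hf : ∀ r > 0, f r = ∫ θ in Ioi r, γ θ)
    {Z : Ω → ℝ} (hZ : IsWienerIntegral W P f Z) :
    ∀ᵐ ω ∂P, Z ω = ∫ θ in Ioi (0 : ℝ), γ θ * B θ.toNNReal ω := by
  obtain ⟨-, hZ2, φ, hφ, hφZ⟩ := hZ
  set Y : Ω → ℝ := fun ω => ∫ θ in Ioi (0 : ℝ), γ θ * B θ.toNNReal ω with hY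
  have hYm : Measurable Y := by
    have hm : Measurable (Function.uncurry fun (θ : ℝ) ω => γ θ * B θ.toNNReal ω) :=
      (hγ.comp measurable_fst).mul
        (hBm.comp ((measurable_real_toNNReal.comp measurable_fst).prodMk measurable_snd))
    exact hm.stronglyMeasurable.integral_prod_left.measurable
  have hφm : ∀ n, Measurable fun ω => (φ n).integral B ω := fun n => by
    have hBt : ∀ t, Measurable (B t) := fun t => hBm.of_uncurry_left
    unfold StepFunction.integral
    fun_prop
  have h1 : Tendsto (fun n => eLpNorm (fun ω => (φ n).integral B ω - Y ω) 2 P) atTop (𝓝 0) := by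
    simp only [hY, hB.eLpNorm_integral_sub hBm hγ hint hγint hf]
    exact hφ
  have h2 : Tendsto (fun n => eLpNorm (fun ω => (φ n).integral B ω - Z ω) 2 P) atTop (𝓝 0) := by
    refine hφZ.congr fun n => eLpNorm_congr_ae ?_
    filter_upwards [hWB] with ω hω
    simp only [StepFunction.integral, hω]
  -- `Z` and `Y` are `L²` limits of the same sequence of step integrals.
  have h3 : eLpNorm (fun ω => Z ω - Y ω) 2 P ≤ 0 := by
    refine le_of_tendsto_of_tendsto' tendsto_const_nhds (by simpa using h1.add h2) fun n => ?_
    have : (fun ω => Z ω - Y ω) = (fun ω => (φ n).integral B ω - Y ω) -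
        (fun ω => (φ n).integral B ω - Z ω) := by
      funext ω; simp
    rw [this]
    exact eLpNorm_sub_le ((hφm n).sub hYm).aestronglyMeasurable
      ((hφm n).aestronglyMeasurable.sub hZ2.aestronglyMeasurable) (by norm_num)
  have h4 := (eLpNorm_eq_zero_iff (hZ2.aestronglyMeasurable.sub hYm.aestronglyMeasurable)
    two_ne_zero).1 (le_antisymm h3 zero_le)
  filter_upwards [h4] with ω hω
  simpa [sub_eq_zero] using hω

end BrownianMotion

/-! ### The Lei–Nualart kernel: bounds, integrability, scaling -/

/-- The profile of the kernel obtained from the Lei-Nualart integrand by integration by parts. -/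
noncomputable def leiNualartProfile (a x : ℝ) : ℝ :=
  a * (1 - Real.exp (-x)) - x * Real.exp (-x)

/-- Minus the derivative in `θ` of `(1 - exp (-θ τ)) θ^{-(1+K)/2}`. -/
noncomputable def leiNualartKernel (K τ θ : ℝ) : ℝ :=
  θ ^ (-(3 + K) / 2) * leiNualartProfile ((1 + K) / 2) (θ * τ)

theorem continuous_leiNualartProfile (a : ℝ) : Continuous (leiNualartProfile a) := by
  unfold leiNualartProfile; fun_prop

theorem measurable_leiNualartKernel (K : ℝ) :
    Measurable (Function.uncurry fun τ θ => leiNualartKernel K τ θ) := by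
  have := (continuous_leiNualartProfile ((1 + K) / 2)).measurable
  unfold leiNualartKernel Function.uncurry
  fun_prop

theorem abs_leiNualartProfile_le {a x : ℝ} (ha : 0 ≤ a) (hx : 0 ≤ x) :
    |leiNualartProfile a x| ≤ (a + 1) * min x 1 := by
  have h1 : 1 - x ≤ Real.exp (-x) := by linarith [Real.add_one_le_exp (-x)]
  have h2 : Real.exp (-x) ≤ 1 := Real.exp_le_one_iff.2 (by linarith)
  have h3 : 0 < Real.exp (-x) := Real.exp_pos _
  have h4 : x * Real.exp (-x) ≤ 1 := by
    rw [Real.exp_neg, ← div_eq_mul_inv, div_le_one (Real.exp_pos _)]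
    linarith [Real.add_one_le_exp x]
  have h5 : x * Real.exp (-x) ≤ min x 1 := le_min (by nlinarith) h4
  have h6 : 1 - Real.exp (-x) ≤ min x 1 := le_min (by linarith) (by linarith)
  have h7 : 0 ≤ x * Real.exp (-x) := by positivity
  have h8 : a * (1 - Real.exp (-x)) ≤ a * min x 1 := mul_le_mul_of_nonneg_left h6 ha
  have h9 : 0 ≤ a * (1 - Real.exp (-x)) := mul_nonneg ha (by linarith)
  unfold leiNualartProfile
  rw [abs_le]
  constructor <;> nlinarith

/-- The derivative is `(a - 1 + z) exp(-z)`. Half of the exponential absorbs the linear factor; the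
other half is the decay that remains. -/
theorem abs_leiNualartProfile_sub_le {a x y : ℝ} (ha : 0 ≤ a) (hx : 0 ≤ x) (hxy : x ≤ y) :
    |leiNualartProfile a y - leiNualartProfile a x| ≤ (a + 2) * Real.exp (-x / 2) * (y - x) := by
  have hd : ∀ z ∈ Icc x y, HasDerivWithinAt (leiNualartProfile a)
      ((a - 1 + z) * Real.exp (-z)) (Icc x y) z := fun z _ => by
    have he : HasDerivAt (fun z : ℝ => Real.exp (-z)) (Real.exp (-z) * -1) z :=
      (hasDerivAt_id z).neg.exp
    have h := ((he.const_sub 1).const_mul a).sub ((hasDerivAt_id z).mul he)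
    refine (HasDerivAt.congr_deriv h ?_).hasDerivWithinAt
    simp only [id]; ring
  have hb : ∀ z ∈ Ico x y, ‖(a - 1 + z) * Real.exp (-z)‖ ≤ (a + 2) * Real.exp (-x / 2) := by
    intro z hz
    have hz0 : 0 ≤ z := hx.trans hz.1
    have h1 : Real.exp (-z) = Real.exp (-z / 2) * Real.exp (-z / 2) := by
      rw [← Real.exp_add]; ring_nf
    have h2 : Real.exp (-z / 2) ≤ Real.exp (-x / 2) := Real.exp_le_exp.2 (by linarith [hz.1])
    have h3 : (z / 2 + 1) * Real.exp (-z / 2) ≤ 1 := by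
      rw [neg_div, Real.exp_neg, ← div_eq_mul_inv, div_le_one (Real.exp_pos _)]
      exact Real.add_one_le_exp _
    have h4 : Real.exp (-z / 2) ≤ 1 := Real.exp_le_one_iff.2 (by linarith)
    have h0 : 0 < Real.exp (-z / 2) := Real.exp_pos _
    have h5 : |a - 1 + z| ≤ a + 1 + z := abs_le.2 ⟨by linarith, by linarith⟩
    rw [Real.norm_eq_abs, abs_mul, Real.abs_exp, h1, ← mul_assoc]
    refine mul_le_mul ?_ h2 h0.le (by linarith)
    calc |a - 1 + z| * Real.exp (-z / 2) ≤ (a + 1 + z) * Real.exp (-z / 2) := by gcongr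
      _ ≤ a + 2 := by nlinarith
  have h := norm_image_sub_le_of_norm_deriv_le_segment' hd hb y (right_mem_Icc.2 hxy)
  simpa [Real.norm_eq_abs] using h

theorem hasDerivAt_leiNualart (K τ : ℝ) {θ : ℝ} (hθ : 0 < θ) :
    HasDerivAt (fun θ : ℝ => (1 - Real.exp (-θ * τ)) * θ ^ (-(1 + K) / 2))
      (-leiNualartKernel K τ θ) θ := by
  have he : HasDerivAt (fun θ : ℝ => Real.exp (-θ * τ)) (Real.exp (-θ * τ) * (-1 * τ)) θ :=
    ((hasDerivAt_id θ).neg.mul_const τ).exp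
  have h := (he.const_sub 1).mul
    (Real.hasDerivAt_rpow_const (x := θ) (p := -(1 + K) / 2) (Or.inl hθ.ne'))
  refine HasDerivAt.congr_deriv h ?_
  have e1 : -(1 + K) / 2 - 1 = -(3 + K) / 2 := by ring
  have e2 : θ ^ (-(1 + K) / 2) = θ ^ (-(3 + K) / 2) * θ := by
    rw [← Real.rpow_add_one hθ.ne']; congr 1; ring
  rw [e1, e2, leiNualartKernel, leiNualartProfile, neg_mul]
  ring_nf

theorem abs_leiNualartKernel_le {K τ θ : ℝ} (hK : 0 < K) (hτ : 0 ≤ τ) (hθ : 0 < θ) :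
    |leiNualartKernel K τ θ| ≤ ((1 + K) / 2 + 1) * (θ ^ (-(3 + K) / 2) * min (θ * τ) 1) := by
  rw [leiNualartKernel, abs_mul, abs_of_pos (Real.rpow_pos_of_pos hθ _), mul_left_comm]
  exact mul_le_mul_of_nonneg_left
    (abs_leiNualartProfile_le (by linarith) (mul_nonneg hθ.le hτ)) (Real.rpow_nonneg hθ.le _)

theorem abs_leiNualartKernel_sub_le {K σ τ θ : ℝ} (hK : 0 < K) (hσ : 0 ≤ σ) (hστ : σ ≤ τ)
    (hθ : 0 < θ) :
    |leiNualartKernel K τ θ - leiNualartKernel K σ θ| ≤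
      ((1 + K) / 2 + 2) * (τ - σ) * (θ ^ (-(1 + K) / 2) * Real.exp (-(σ / 2 * θ))) := by
  have h := abs_leiNualartProfile_sub_le (a := (1 + K) / 2) (by linarith) (mul_nonneg hθ.le hσ)
    (mul_le_mul_of_nonneg_left hστ hθ.le)
  have e2 : θ ^ (-(1 + K) / 2) = θ ^ (-(3 + K) / 2) * θ := by
    rw [← Real.rpow_add_one hθ.ne']; congr 1; ring
  rw [leiNualartKernel, leiNualartKernel, ← mul_sub, abs_mul,
    abs_of_pos (Real.rpow_pos_of_pos hθ _), e2]
  refine (mul_le_mul_of_nonneg_left h (Real.rpow_nonneg hθ.le _)).trans_eq ?_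
  rw [show -(θ * σ) / 2 = -(σ / 2 * θ) by ring]
  ring

/-- Near `0` the integrand is `x^{-K/2}`, where `K < 2` is needed; at infinity it is `x^{-1-K/2}`,
where `K > 0` is needed. -/
theorem integrableOn_rpow_mul_min {K : ℝ} (hK : 0 < K) (hK' : K < 2) :
    IntegrableOn (fun x : ℝ => x ^ (-1 - K / 2) * min x 1) (Ioi 0) := by
  rw [← Ioc_union_Ioi_eq_Ioi (zero_le_one (α := ℝ))]
  refine IntegrableOn.union ?_ ?_
  · have h : IntegrableOn (fun x : ℝ => x ^ (-K / 2)) (Ioc 0 1) :=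
      (intervalIntegrable_iff_integrableOn_Ioc_of_le zero_le_one).1
        (intervalIntegral.intervalIntegrable_rpow' (by linarith))
    refine (integrableOn_congr_fun (fun x hx => ?_) measurableSet_Ioc).2 h
    simp only [min_eq_left hx.2]
    rw [← Real.rpow_add_one hx.1.ne']; congr 1; ring
  · refine (integrableOn_congr_fun (fun x hx => ?_) measurableSet_Ioi).2
      (integrableOn_Ioi_rpow_of_lt (a := -1 - K / 2) (by linarith) zero_lt_one)
    simp only [min_eq_right (le_of_lt (mem_Ioi.1 hx)), mul_one]

theorem integrableOn_rpow_mul_min_mul {K τ : ℝ} (hK : 0 < K) (hK' : K < 2) (hτ : 0 < τ) :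
    IntegrableOn (fun x : ℝ => x ^ (-1 - K / 2) * min (x * τ) 1) (Ioi 0) ∧
    ∫ x in Ioi (0 : ℝ), x ^ (-1 - K / 2) * min (x * τ) 1 =
      τ ^ (K / 2) * ∫ x in Ioi (0 : ℝ), x ^ (-1 - K / 2) * min x 1 := by
  have e : ∀ x ∈ Ioi (0 : ℝ), x ^ (-1 - K / 2) * min (x * τ) 1 =
      τ ^ (1 + K / 2) * ((x * τ) ^ (-1 - K / 2) * min (x * τ) 1) := by
    intro x hx
    rw [Real.mul_rpow (le_of_lt hx) hτ.le, ← mul_assoc, mul_left_comm,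
      ← Real.rpow_add hτ, show 1 + K / 2 + (-1 - K / 2) = 0 by ring, Real.rpow_zero, mul_one]
  constructor
  · refine (integrableOn_congr_fun e measurableSet_Ioi).2 (Integrable.const_mul ?_ _)
    have := (integrableOn_Ioi_comp_mul_right_iff
      (fun x : ℝ => x ^ (-1 - K / 2) * min x 1) 0 hτ).2
    exact this (by simpa using integrableOn_rpow_mul_min hK hK')
  · rw [setIntegral_congr_fun measurableSet_Ioi e, integral_const_mul,
      integral_comp_mul_right_Ioi (fun x : ℝ => x ^ (-1 - K / 2) * min x 1) 0 hτ, zero_mul,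
      smul_eq_mul, ← mul_assoc, ← Real.rpow_neg_one τ, ← Real.rpow_add hτ]
    congr 2; ring

theorem rpow_mul_sqrt {K θ : ℝ} (hθ : 0 < θ) :
    θ ^ (-(3 + K) / 2) * √θ = θ ^ (-1 - K / 2) ∧ θ ^ (-(1 + K) / 2) * √θ = θ ^ (-K / 2) := by
  rw [Real.sqrt_eq_rpow, ← Real.rpow_add hθ, ← Real.rpow_add hθ]
  constructor <;> congr 1 <;> ring

theorem integrableOn_leiNualartKernel_mul_sqrt {K τ : ℝ} (hK : 0 < K) (hK' : K < 2) (hτ : 0 < τ) :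
    IntegrableOn (fun θ => leiNualartKernel K τ θ * √θ) (Ioi 0) := by
  have hm : Measurable (leiNualartKernel K τ) := (measurable_leiNualartKernel K).of_uncurry_left
  refine ((integrableOn_rpow_mul_min_mul hK hK' hτ).1.const_mul ((1 + K) / 2 + 1)).mono'
    (hm.mul Real.continuous_sqrt.measurable).aestronglyMeasurable ?_
  filter_upwards [ae_restrict_mem measurableSet_Ioi] with θ hθ
  rw [norm_mul, Real.norm_eq_abs, Real.norm_of_nonneg (Real.sqrt_nonneg _)]
  refine (mul_le_mul_of_nonneg_right (abs_leiNualartKernel_le hK hτ.le hθ)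
    (Real.sqrt_nonneg _)).trans_eq ?_
  rw [← (rpow_mul_sqrt hθ).1]
  ring

theorem integrableOn_leiNualartKernel {K τ r : ℝ} (hK : 0 < K) (hτ : 0 < τ) (hr : 0 < r) :
    IntegrableOn (leiNualartKernel K τ) (Ioi r) := by
  have hm : Measurable (leiNualartKernel K τ) := (measurable_leiNualartKernel K).of_uncurry_left
  refine ((integrableOn_Ioi_rpow_of_lt (a := -(3 + K) / 2) (by linarith) hr).const_mul
    ((1 + K) / 2 + 1)).mono' hm.aestronglyMeasurable ?_
  filter_upwards [ae_restrict_mem measurableSet_Ioi] with θ hθ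
  have hθ0 : 0 < θ := hr.trans hθ
  refine (abs_leiNualartKernel_le hK hτ.le hθ0).trans ?_
  refine mul_le_mul_of_nonneg_left ?_ (by linarith)
  exact mul_le_of_le_one_right (Real.rpow_nonneg hθ0.le _) (min_le_right _ _)

theorem integral_leiNualartKernel {K τ r : ℝ} (hK : 0 < K) (hτ : 0 < τ) (hr : 0 < r) :
    (1 - Real.exp (-r * τ)) * r ^ (-(1 + K) / 2) = ∫ θ in Ioi r, leiNualartKernel K τ θ := by
  have hlim : Tendsto (fun θ : ℝ => (1 - Real.exp (-θ * τ)) * θ ^ (-(1 + K) / 2)) atTop (𝓝 0) := by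
    have h1 : Tendsto (fun θ : ℝ => θ ^ (-(1 + K) / 2)) atTop (𝓝 0) := by
      have := tendsto_rpow_neg_atTop (y := (1 + K) / 2) (by linarith)
      simpa only [neg_div] using this
    refine squeeze_zero_norm' ?_ h1
    filter_upwards [eventually_gt_atTop 0] with θ hθ
    have h2 : Real.exp (-θ * τ) ≤ 1 := Real.exp_le_one_iff.2 (by nlinarith)
    rw [norm_mul, Real.norm_of_nonneg (by linarith : 0 ≤ 1 - Real.exp (-θ * τ)),
      Real.norm_of_nonneg (Real.rpow_nonneg hθ.le _)]
    exact mul_le_of_le_one_left (Real.rpow_nonneg hθ.le _) (by linarith [Real.exp_pos (-θ * τ)])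
  have h := integral_Ioi_of_hasDerivAt_of_tendsto'
    (fun θ hθ => hasDerivAt_leiNualart K τ (hr.trans_le hθ))
    (integrableOn_leiNualartKernel hK hτ hr).neg hlim
  rw [integral_neg] at h
  linarith

/-! ### Gaussian exponential moments -/

theorem integrable_exp_sq_div_four_gaussianReal :
    Integrable (fun x : ℝ => Real.exp (x ^ 2 / 4)) (gaussianReal 0 1) := by
  rw [gaussianReal_of_var_ne_zero 0 one_ne_zero, integrable_withDensity_iff
    (measurable_gaussianPDF 0 1) (ae_of_all _ fun _ => gaussianPDF_lt_top)]
  refine ((integrable_exp_neg_mul_sq (b := 1 / 4) (by norm_num)).const_mul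
    (√(2 * Real.pi))⁻¹).congr (ae_of_all _ fun x => ?_)
  simp only [toReal_gaussianPDF, gaussianPDFReal, NNReal.coe_one, mul_one, sub_zero]
  rw [mul_left_comm, ← Real.exp_add]
  congr 2
  ring

theorem ProbabilityTheory.IsPreBrownianReal.exp_sq_div {Ω : Type*} [MeasurableSpace Ω]
    {P : Measure Ω} {B : ℝ≥0 → Ω → ℝ} (hB : IsPreBrownianReal B P) {θ : ℝ} (hθ : 0 < θ) :
    Integrable (fun ω => Real.exp (B θ.toNNReal ω ^ 2 / (4 * θ))) P ∧
      ∫ ω, Real.exp (B θ.toNNReal ω ^ 2 / (4 * θ)) ∂P =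
        ∫ x, Real.exp (x ^ 2 / 4) ∂gaussianReal 0 1 := by
  have hlaw : HasLaw (fun ω => B θ.toNNReal ω / √θ) (gaussianReal 0 1) P := by
    have h := gaussianReal_div_const (hB.hasLaw_eval θ.toNNReal) (√θ)
    convert! h using 1
    congr 1
    · simp
    · ext
      simp [Real.sq_sqrt hθ.le, Real.coe_toNNReal _ hθ.le, hθ.ne']
  have e : ∀ ω, Real.exp (B θ.toNNReal ω ^ 2 / (4 * θ)) =
      (fun x : ℝ => Real.exp (x ^ 2 / 4)) (B θ.toNNReal ω / √θ) := fun ω => by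
    simp only [div_pow, Real.sq_sqrt hθ.le]
    congr 1
    field_simp
  have hm : Measurable fun x : ℝ => Real.exp (x ^ 2 / 4) := by fun_prop
  simp only [e]
  constructor
  · have := integrable_exp_sq_div_four_gaussianReal
    rw [← hlaw.map_eq] at this
    exact this.comp_aemeasurable hlaw.aemeasurable
  · rw [← hlaw.map_eq, integral_map hlaw.aemeasurable hm.aestronglyMeasurable]

/-- By scaling, the exponential moment is the same for all `θ > 0`, so Fubini needs only the
integrability of `m`. -/
theorem ProbabilityTheory.IsPreBrownianReal.ae_integrableOn_mul_exp_sq_div {Ω : Type*}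
    [MeasurableSpace Ω] {P : Measure Ω} {B : ℝ≥0 → Ω → ℝ} (hB : IsPreBrownianReal B P)
    (hBm : Measurable (Function.uncurry B)) {m : ℝ → ℝ} (hm : Measurable m)
    (hint : IntegrableOn m (Ioi 0)) :
    ∀ᵐ ω ∂P, IntegrableOn (fun θ => m θ * Real.exp (B θ.toNNReal ω ^ 2 / (4 * θ))) (Ioi 0) := by
  have : IsProbabilityMeasure P := hB.isGaussianProcess.isProbabilityMeasure
  have hBm' : Measurable fun p : ℝ × Ω => B p.1.toNNReal p.2 :=
    hBm.comp ((measurable_real_toNNReal.comp measurable_fst).prodMk measurable_snd)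
  have hFm : Measurable (Function.uncurry fun (θ : ℝ) ω =>
      m θ * Real.exp (B θ.toNNReal ω ^ 2 / (4 * θ))) := by
    unfold Function.uncurry
    fun_prop
  refine Integrable.prod_left_ae (f := Function.uncurry fun (θ : ℝ) ω =>
      m θ * Real.exp (B θ.toNNReal ω ^ 2 / (4 * θ))) ?_
  rw [integrable_prod_iff hFm.aestronglyMeasurable]
  constructor
  · filter_upwards [ae_restrict_mem measurableSet_Ioi] with θ hθ
    exact (hB.exp_sq_div hθ).1.const_mul (m θ)
  · refine (hint.norm.mul_const (∫ x, Real.exp (x ^ 2 / 4) ∂gaussianReal 0 1)).congr ?_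
    filter_upwards [ae_restrict_mem measurableSet_Ioi] with θ hθ
    simp only [Function.uncurry, norm_mul, integral_const_mul, Real.norm_eq_abs, Real.abs_exp]
    rw [(hB.exp_sq_div hθ).2]

/-! ### Pathwise bounds by splitting at a level -/

/-- If `u > L`, the combined exponent is at least `u² / 8`, and `2 exp(u² / 8) ≥ u`. -/
theorem le_add_two_mul_exp {u L : ℝ} (hL : 0 ≤ L) :
    u ≤ L + 2 * Real.exp (-L ^ 2 / 8) * Real.exp (u ^ 2 / 4) := by
  rcases le_or_gt u L with h | h
  · have : 0 < Real.exp (-L ^ 2 / 8) * Real.exp (u ^ 2 / 4) := by positivity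
    linarith
  · rw [mul_assoc, ← Real.exp_add]
    have h1 := Real.add_one_le_exp (-L ^ 2 / 8 + u ^ 2 / 4)
    nlinarith [sq_nonneg (u - 4)]

theorem integral_mul_abs_div_sqrt_le {b k m : ℝ → ℝ} {R L : ℝ} (hL : 0 ≤ L)
    (hb : Measurable b) (hkm : Measurable k) (hk0 : ∀ θ > 0, 0 ≤ k θ)
    (hk : IntegrableOn k (Ioi 0)) (hkR : ∀ θ > 0, k θ ≤ R * m θ)
    (hA : IntegrableOn (fun θ => m θ * Real.exp (b θ ^ 2 / (4 * θ))) (Ioi 0)) :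
    IntegrableOn (fun θ => k θ * (|b θ| / √θ)) (Ioi 0) ∧
    ∫ θ in Ioi (0 : ℝ), k θ * (|b θ| / √θ) ≤ L * (∫ θ in Ioi (0 : ℝ), k θ) +
      2 * Real.exp (-L ^ 2 / 8) * R *
        ∫ θ in Ioi (0 : ℝ), m θ * Real.exp (b θ ^ 2 / (4 * θ)) := by
  have hbd : ∀ θ ∈ Ioi (0 : ℝ), k θ * (|b θ| / √θ) ≤
      L * k θ + 2 * Real.exp (-L ^ 2 / 8) * R * (m θ * Real.exp (b θ ^ 2 / (4 * θ))) := by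
    intro θ hθ
    have hθ' : (0 : ℝ) < θ := hθ
    have h1 := le_add_two_mul_exp (u := |b θ| / √θ) hL
    have h2 : (|b θ| / √θ) ^ 2 / 4 = b θ ^ 2 / (4 * θ) := by
      rw [div_pow, sq_abs, Real.sq_sqrt hθ'.le]; field_simp
    rw [h2] at h1
    have h3 : 0 ≤ 2 * Real.exp (-L ^ 2 / 8) * Real.exp (b θ ^ 2 / (4 * θ)) := by positivity
    calc k θ * (|b θ| / √θ)
        ≤ k θ * (L + 2 * Real.exp (-L ^ 2 / 8) * Real.exp (b θ ^ 2 / (4 * θ))) :=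
          mul_le_mul_of_nonneg_left h1 (hk0 θ hθ)
      _ = L * k θ + k θ * (2 * Real.exp (-L ^ 2 / 8) * Real.exp (b θ ^ 2 / (4 * θ))) := by ring
      _ ≤ L * k θ + R * m θ * (2 * Real.exp (-L ^ 2 / 8) * Real.exp (b θ ^ 2 / (4 * θ))) := by
          gcongr
          exact hkR θ hθ
      _ = _ := by ring
  have hi : IntegrableOn (fun θ => L * k θ +
      2 * Real.exp (-L ^ 2 / 8) * R * (m θ * Real.exp (b θ ^ 2 / (4 * θ)))) (Ioi 0) :=
    (hk.const_mul L).add (hA.const_mul _)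
  have hint : IntegrableOn (fun θ => k θ * (|b θ| / √θ)) (Ioi 0) := by
    refine hi.mono' (by fun_prop) ?_
    filter_upwards [ae_restrict_mem measurableSet_Ioi] with θ hθ
    rw [Real.norm_of_nonneg (mul_nonneg (hk0 θ hθ) (by positivity))]
    exact hbd θ hθ
  refine ⟨hint, (setIntegral_mono_on hint hi measurableSet_Ioi hbd).trans_eq ?_⟩
  rw [integral_add (hk.const_mul L) (hA.const_mul _), integral_const_mul, integral_const_mul]

/-- This level makes the exponential remainder as small as the mass `τ^{K/2}` of the dominating
kernel. -/
theorem exp_neg_sq_sqrt_log {K τ : ℝ} (hK : 0 < K) (hτ : 0 < τ) (hτ1 : τ ≤ 1) :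
    Real.exp (-(√(4 * K) * √(Real.log (1 / τ))) ^ 2 / 8) = τ ^ (K / 2) := by
  have h : 0 ≤ Real.log (1 / τ) := Real.log_nonneg (by rw [le_div_iff₀ hτ]; linarith)
  rw [mul_pow, Real.sq_sqrt (by positivity), Real.sq_sqrt h, Real.rpow_def_of_pos hτ, one_div,
    Real.log_inv]
  congr 1; ring

theorem exists_leiNualart_path_bounds {K : ℝ} (hK : 0 < K) (hK' : K < 2) {b : ℝ → ℝ}
    (hb : Measurable b)
    (hA : IntegrableOn (fun θ => θ ^ (-1 - K / 2) * min θ 1 * Real.exp (b θ ^ 2 / (4 * θ)))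
      (Ioi 0)) :
    ∃ D : ℝ, 0 ≤ D ∧
      (∀ τ : ℝ, 0 < τ → τ ≤ 1 → |∫ θ in Ioi (0 : ℝ), leiNualartKernel K τ θ * b θ| ≤
        D * (τ ^ (K / 2) * (1 + √(Real.log (1 / τ))))) ∧
      ∀ σ τ : ℝ, 0 < σ → σ ≤ τ → τ ≤ 1 →
        |(∫ θ in Ioi (0 : ℝ), leiNualartKernel K τ θ * b θ) -
          ∫ θ in Ioi (0 : ℝ), leiNualartKernel K σ θ * b θ| ≤
        D * ((τ - σ) * σ ^ (K / 2 - 1) * (1 + √(Real.log (1 / σ)))) := by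
  set A := ∫ θ in Ioi (0 : ℝ), θ ^ (-1 - K / 2) * min θ 1 * Real.exp (b θ ^ 2 / (4 * θ)) with hAdef
  have hA0 : 0 ≤ A := setIntegral_nonneg measurableSet_Ioi fun θ hθ => by
    have : (0 : ℝ) < θ := hθ
    positivity
  have hkm : ∀ τ, Measurable (leiNualartKernel K τ) := fun τ =>
    (measurable_leiNualartKernel K).of_uncurry_left
  set C₁ := ∫ x in Ioi (0 : ℝ), x ^ (-1 - K / 2) * min x 1
  have hC₁ : 0 ≤ C₁ := setIntegral_nonneg measurableSet_Ioi fun θ hθ => by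
    have : (0 : ℝ) < θ := hθ
    positivity
  -- integrability and the bound for one value of the parameter
  have hone : ∀ τ : ℝ, 0 < τ → τ ≤ 1 →
      IntegrableOn (fun θ => leiNualartKernel K τ θ * b θ) (Ioi 0) ∧
      |∫ θ in Ioi (0 : ℝ), leiNualartKernel K τ θ * b θ| ≤
        (((1 + K) / 2 + 1) * (√(4 * K) * C₁ + 2 * A)) *
          (τ ^ (K / 2) * (1 + √(Real.log (1 / τ)))) := by
    intro τ hτ hτ1
    -- `R = 1` suffices because `τ ≤ 1` gives `min (θ * τ) 1 ≤ min θ 1`.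
    obtain ⟨hi, hle⟩ := integral_mul_abs_div_sqrt_le (b := b)
      (k := fun x : ℝ => x ^ (-1 - K / 2) * min (x * τ) 1)
      (m := fun x : ℝ => x ^ (-1 - K / 2) * min x 1) (R := 1)
      (L := √(4 * K) * √(Real.log (1 / τ))) (by positivity) hb (by fun_prop)
      (fun θ hθ => by positivity) (integrableOn_rpow_mul_min_mul hK hK' hτ).1
      (fun θ hθ => by
        rw [one_mul]
        gcongr
        nlinarith) hA
    rw [exp_neg_sq_sqrt_log hK hτ hτ1, (integrableOn_rpow_mul_min_mul hK hK' hτ).2, ← hAdef] at hle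
    have hpt : ∀ θ ∈ Ioi (0 : ℝ), ‖leiNualartKernel K τ θ * b θ‖ ≤ ((1 + K) / 2 + 1) *
        (θ ^ (-1 - K / 2) * min (θ * τ) 1 * (|b θ| / √θ)) := by
      intro θ hθ
      have hθ' : (0 : ℝ) < θ := hθ
      rw [norm_mul, Real.norm_eq_abs, Real.norm_eq_abs]
      refine (mul_le_mul_of_nonneg_right (abs_leiNualartKernel_le hK hτ.le hθ)
        (abs_nonneg _)).trans_eq ?_
      rw [← (rpow_mul_sqrt hθ').1]
      field_simp
    have hpt' : ∀ᵐ θ ∂volume.restrict (Ioi (0 : ℝ)), ‖leiNualartKernel K τ θ * b θ‖ ≤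
        ((1 + K) / 2 + 1) * (θ ^ (-1 - K / 2) * min (θ * τ) 1 * (|b θ| / √θ)) :=
      (ae_restrict_mem measurableSet_Ioi).mono hpt
    refine ⟨(hi.const_mul _).mono' ((hkm τ).mul hb).aestronglyMeasurable hpt', ?_⟩
    refine (norm_integral_le_of_norm_le (hi.const_mul _) hpt').trans ?_
    rw [integral_const_mul, mul_assoc ((1 + K) / 2 + 1)]
    refine mul_le_mul_of_nonneg_left (hle.trans ?_) (by linarith)
    have h1 : 0 ≤ τ ^ (K / 2) * (√(4 * K) * C₁) := by positivity
    have h2 : 0 ≤ τ ^ (K / 2) * (2 * A) * √(Real.log (1 / τ)) := by positivity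
    linarith
  set C₂ := (2 : ℝ) ^ (1 - K / 2) * Real.Gamma (1 - K / 2)
  have hC₂ : 0 ≤ C₂ := mul_nonneg (by positivity) (Real.Gamma_pos_of_pos (by linarith)).le
  have htwo : ∀ σ τ : ℝ, 0 < σ → σ ≤ τ → τ ≤ 1 →
      |(∫ θ in Ioi (0 : ℝ), leiNualartKernel K τ θ * b θ) -
        ∫ θ in Ioi (0 : ℝ), leiNualartKernel K σ θ * b θ| ≤
      (((1 + K) / 2 + 2) * (√(4 * K) * C₂ + 4 * A)) *
        ((τ - σ) * σ ^ (K / 2 - 1) * (1 + √(Real.log (1 / σ)))) := by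
    intro σ τ hσ hστ hτ1
    have hσ1 : σ ≤ 1 := hστ.trans hτ1
    have hkI : IntegrableOn (fun x : ℝ => x ^ (-K / 2) * Real.exp (-(σ / 2 * x))) (Ioi 0) := by
      have := integrableOn_rpow_mul_exp_neg_mul_rpow (p := 1) (s := -K / 2) (b := σ / 2)
        (by linarith) one_pos (by linarith)
      simpa only [Real.rpow_one, neg_mul] using this
    have hkint : ∫ x in Ioi (0 : ℝ), x ^ (-K / 2) * Real.exp (-(σ / 2 * x)) =
        C₂ * σ ^ (K / 2 - 1) := by
      have := Real.integral_rpow_mul_exp_neg_mul_Ioi (a := 1 - K / 2) (r := σ / 2)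
        (by linarith) (by linarith)
      rw [show 1 - K / 2 - 1 = -K / 2 by ring] at this
      rw [this, one_div_div, Real.div_rpow (by norm_num) hσ.le,
        show K / 2 - 1 = -(1 - K / 2) by ring, Real.rpow_neg hσ.le]
      simp only [C₂]
      ring
    -- `R = 2 / σ` bounds both `θ exp(-σθ/2)` and `1`. Times the remainder `σ^{K/2}` it has the
    -- order `σ^{K/2-1}` of the Gamma integral `hkint`.
    obtain ⟨hi, hle⟩ := integral_mul_abs_div_sqrt_le (b := b)
      (k := fun x : ℝ => x ^ (-K / 2) * Real.exp (-(σ / 2 * x)))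
      (m := fun x : ℝ => x ^ (-1 - K / 2) * min x 1) (R := 2 / σ)
      (L := √(4 * K) * √(Real.log (1 / σ))) (by positivity) hb (by fun_prop)
      (fun θ hθ => by positivity) hkI
      (fun θ hθ => by
        have e : θ ^ (-K / 2) = θ ^ (-1 - K / 2) * θ := by
          rw [← Real.rpow_add_one (ne_of_gt hθ)]; congr 1; ring
        rw [e, mul_assoc, mul_left_comm (2 / σ)]
        refine mul_le_mul_of_nonneg_left ?_ (Real.rpow_nonneg (le_of_lt hθ) _)
        have h1 : Real.exp (-(σ / 2 * θ)) ≤ 1 :=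
          Real.exp_le_one_iff.2 (neg_nonpos.2 (by positivity))
        have h2 : σ / 2 * θ * Real.exp (-(σ / 2 * θ)) ≤ 1 := by
          rw [Real.exp_neg, ← div_eq_mul_inv, div_le_one (Real.exp_pos _)]
          linarith [Real.add_one_le_exp (σ / 2 * θ)]
        have h3 : θ * Real.exp (-(σ / 2 * θ)) ≤ 2 / σ := by
          rw [le_div_iff₀ hσ]; nlinarith
        have h4 : 1 ≤ 2 / σ := by rw [le_div_iff₀ hσ]; linarith
        rcases min_cases θ 1 with ⟨h, _⟩ | ⟨h, _⟩ <;> rw [h]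
        · nlinarith [mul_le_of_le_one_right (le_of_lt hθ) h1,
            mul_le_mul_of_nonneg_right h4 (le_of_lt hθ)]
        · simpa using h3) hA
    rw [exp_neg_sq_sqrt_log hK hσ hσ1, hkint, ← hAdef] at hle
    have hsub : 0 ≤ τ - σ := by linarith
    have hpt : ∀ᵐ θ ∂volume.restrict (Ioi (0 : ℝ)),
        ‖leiNualartKernel K τ θ * b θ - leiNualartKernel K σ θ * b θ‖ ≤
        ((1 + K) / 2 + 2) * (τ - σ) *
          (θ ^ (-K / 2) * Real.exp (-(σ / 2 * θ)) * (|b θ| / √θ)) := by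
      filter_upwards [ae_restrict_mem measurableSet_Ioi] with θ hθ
      have hθ' : (0 : ℝ) < θ := hθ
      rw [← sub_mul, norm_mul, Real.norm_eq_abs, Real.norm_eq_abs]
      refine (mul_le_mul_of_nonneg_right (abs_leiNualartKernel_sub_le hK hσ.le hστ hθ)
        (abs_nonneg _)).trans_eq ?_
      have hu : |b θ| = √θ * (|b θ| / √θ) := (mul_div_cancel₀ _ (Real.sqrt_pos.2 hθ').ne').symm
      generalize |b θ| / √θ = u at hu ⊢
      rw [hu, ← (rpow_mul_sqrt (K := K) hθ').2]
      ring
    rw [← integral_sub (hone τ (hσ.trans_le hστ) hτ1).1 (hone σ hσ hσ1).1]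
    refine (norm_integral_le_of_norm_le (hi.const_mul _) hpt).trans ?_
    rw [integral_const_mul]
    have e : σ ^ (K / 2) * (2 / σ) = 2 * σ ^ (K / 2 - 1) := by
      rw [Real.rpow_sub_one hσ.ne']; ring
    have hle' : ∫ θ in Ioi (0 : ℝ), θ ^ (-K / 2) * Real.exp (-(σ / 2 * θ)) * (|b θ| / √θ) ≤
        (√(4 * K) * C₂ + 4 * A) * (σ ^ (K / 2 - 1) * (1 + √(Real.log (1 / σ)))) := by
      refine hle.trans ?_
      have h1 : 0 ≤ σ ^ (K / 2 - 1) * (√(4 * K) * C₂) := by positivity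
      have h2 : 0 ≤ σ ^ (K / 2 - 1) * (4 * A) * √(Real.log (1 / σ)) := by positivity
      rw [mul_assoc 2 (σ ^ (K / 2)), e]
      linarith
    refine (mul_le_mul_of_nonneg_left hle' (mul_nonneg (by linarith) hsub)).trans_eq ?_
    ring
  refine ⟨max (((1 + K) / 2 + 1) * (√(4 * K) * C₁ + 2 * A))
    (((1 + K) / 2 + 2) * (√(4 * K) * C₂ + 4 * A)), le_max_of_le_left (by positivity),
    fun τ hτ hτ1 => (hone τ hτ hτ1).2.trans ?_, fun σ τ hσ hστ hτ1 => (htwo σ τ hσ hστ hτ1).trans ?_⟩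
  · exact mul_le_mul_of_nonneg_right (le_max_left _ _) (by positivity)
  · have hsub : 0 ≤ τ - σ := by linarith
    exact mul_le_mul_of_nonneg_right (le_max_right _ _) (by positivity)

/-! ### Pointwise bounds for increments -/

theorem rpow_mul_sqrt_log_le {α u : ℝ} (hα : 0 < α) (hu : 0 < u) (hu1 : u ≤ 1) :
    u ^ α * √(Real.log (1 / u)) ≤ 1 + 1 / α := by
  have hl : 0 ≤ Real.log (1 / u) := Real.log_nonneg (by rw [le_div_iff₀ hu]; linarith)
  have h1 : √(Real.log (1 / u)) ≤ 1 + Real.log (1 / u) :=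
    (Real.sqrt_le_left (by linarith)).2 (by nlinarith)
  have h2 : Real.log (1 / u) ≤ (1 / u) ^ α / α := Real.log_le_rpow_div (by positivity) hα
  have h3 : u ^ α * (1 / u) ^ α = 1 := by
    rw [← Real.mul_rpow hu.le (by positivity), mul_one_div_cancel hu.ne', Real.one_rpow]
  have h4 : u ^ α ≤ 1 := Real.rpow_le_one hu.le hu1 hα.le
  calc u ^ α * √(Real.log (1 / u)) ≤ u ^ α * (1 + (1 / u) ^ α / α) := by
        gcongr; linarith
    _ = u ^ α + (u ^ α * (1 / u) ^ α) / α := by ring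
    _ ≤ 1 + 1 / α := by rw [h3]; linarith

theorem rpow_add_sub_rpow_le {p s h : ℝ} (hp : p ≤ 2) (hh : 0 ≤ h) (hs : 0 < s) (hhs : h ≤ s) :
    (s + h) ^ p - s ^ p ≤ 3 * h * s ^ (p - 1) := by
  have hx : 0 ≤ h / s := by positivity
  have hx1 : h / s ≤ 1 := (div_le_one hs).2 hhs
  have h1 : (1 + h / s) ^ p ≤ 1 + 3 * (h / s) := by
    calc (1 + h / s) ^ p ≤ (1 + h / s) ^ (2 : ℝ) :=
          Real.rpow_le_rpow_of_exponent_le (by linarith) hp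
      _ = (1 + h / s) ^ 2 := by norm_cast
      _ ≤ 1 + 3 * (h / s) := by nlinarith
  have h2 : (s + h) ^ p = s ^ p * (1 + h / s) ^ p := by
    rw [← Real.mul_rpow hs.le (by positivity)]; congr 1; field_simp
  have h3 : s ^ p * (3 * (h / s)) = 3 * h * s ^ (p - 1) := by
    rw [Real.rpow_sub_one hs.ne']; ring
  have h4 := mul_le_mul_of_nonneg_left h1 (Real.rpow_nonneg hs.le p)
  rw [h2]
  linarith

/-- For `s ≥ h` the increment bound is used: `t^{2H}` varies by at most `3 h s^{2H-1}`, and `2H`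
cancels. For `s < h` the two values are bounded separately; the excess `√log(h/s)` is absorbed by
`(s/h)^α`, at the cost of the `1 / α` in the constant. -/
theorem abs_increment_le {α H D : ℝ} (hα : 0 < α) (hα1 : α < 1) (hH1 : H < 1) (hD : 0 ≤ D)
    {y : ℝ → ℝ} (h1 : ∀ t ∈ Ioo (0 : ℝ) 1, |y t| ≤ D * (t ^ α * (1 + √(Real.log (1 / t)))))
    (h2 : ∀ s t : ℝ, 0 < s → s ≤ t → t < 1 → |y t - y s| ≤
      D * ((t ^ (2 * H) - s ^ (2 * H)) * s ^ (α - 2 * H) * (1 + √(Real.log (1 / s)))))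
    {h s : ℝ} (hh : 0 < h) (hs : 0 < s) (hsh : s + h < 1) :
    |y (s + h) - y s| ≤ (4 + 1 / α) * D * h ^ α * (1 + √(Real.log (1 / h))) *
      min 1 ((s / h) ^ (α - 1)) := by
  have hh1 : h < 1 := by linarith
  have hl : 0 ≤ Real.log (1 / h) := Real.log_nonneg (by rw [le_div_iff₀ hh]; linarith)
  set ℓ := √(Real.log (1 / h)) with hℓ
  have hℓ0 : 0 ≤ ℓ := Real.sqrt_nonneg _
  have hαi : 0 < 1 / α := by positivity
  have hmono : ∀ t, h ≤ t → √(Real.log (1 / t)) ≤ ℓ := fun t ht =>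
    Real.sqrt_le_sqrt (Real.log_le_log (by have := hh.trans_le ht; positivity)
      (one_div_le_one_div_of_le hh ht))
  rcases le_or_gt h s with hcase | hcase
  · have e : min 1 ((s / h) ^ (α - 1)) = (s / h) ^ (α - 1) :=
      min_eq_right (Real.rpow_le_one_of_one_le_of_nonpos ((one_le_div hh).2 hcase) (by linarith))
    rw [e]
    have e1 : h ^ α * (s / h) ^ (α - 1) = h * s ^ (α - 1) := by
      rw [Real.div_rpow hs.le hh.le, Real.rpow_sub_one hh.ne']
      have := (Real.rpow_pos_of_pos hh α).ne'
      field_simp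
    have e2 : s ^ (2 * H - 1) * s ^ (α - 2 * H) = s ^ (α - 1) := by
      rw [← Real.rpow_add hs]; congr 1; ring
    calc |y (s + h) - y s|
        ≤ D * (((s + h) ^ (2 * H) - s ^ (2 * H)) * s ^ (α - 2 * H) *
          (1 + √(Real.log (1 / s)))) := h2 s (s + h) hs (by linarith) hsh
      _ ≤ D * ((3 * h * s ^ (2 * H - 1)) * s ^ (α - 2 * H) * (1 + ℓ)) := by
          gcongr
          · exact rpow_add_sub_rpow_le (by linarith) hh.le hs hcase
          · exact hmono s hcase
      _ = 3 * (D * (h * s ^ (α - 1)) * (1 + ℓ)) := by rw [← e2]; ring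
      _ ≤ (4 + 1 / α) * (D * (h * s ^ (α - 1)) * (1 + ℓ)) := by
          gcongr; linarith
      _ = _ := by rw [← e1]; ring
  · have e : min 1 ((s / h) ^ (α - 1)) = 1 :=
      min_eq_left (Real.one_le_rpow_of_pos_of_le_one_of_nonpos (by positivity)
        ((div_le_one hh).2 hcase.le) (by linarith))
    rw [e, mul_one]
    have b1 : |y (s + h)| ≤ D * (2 * h ^ α * (1 + ℓ)) := by
      refine (h1 (s + h) ⟨by linarith, hsh⟩).trans ?_
      have : (s + h) ^ α ≤ 2 * h ^ α := by
        calc (s + h) ^ α ≤ (2 * h) ^ α := by gcongr; linarith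
          _ = 2 ^ α * h ^ α := Real.mul_rpow (by norm_num) hh.le
          _ ≤ 2 ^ (1 : ℝ) * h ^ α := by
            gcongr
            norm_num
          _ = 2 * h ^ α := by rw [Real.rpow_one]
      gcongr
      exact hmono _ (by linarith)
    have b2 : |y s| ≤ D * (h ^ α * (1 + ℓ + (1 + 1 / α))) := by
      refine (h1 s ⟨hs, by linarith⟩).trans ?_
      set u := s / h with hu
      have hu0 : 0 < u := by positivity
      have hu1 : u ≤ 1 := (div_le_one hh).2 hcase.le
      have es : s = h * u := by rw [hu]; field_simp
      have elog : Real.log (1 / s) = Real.log (1 / h) + Real.log (1 / u) := by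
        rw [← Real.log_mul (by positivity) (by positivity), es]; congr 1; field_simp
      have b3 : √(Real.log (1 / s)) ≤ ℓ + √(Real.log (1 / u)) := by
        have hu' : 0 ≤ Real.log (1 / u) := Real.log_nonneg ((one_le_div hu0).2 hu1)
        rw [elog, hℓ]
        refine (Real.sqrt_le_left (by positivity)).2 ?_
        rw [add_sq, Real.sq_sqrt hl, Real.sq_sqrt hu']
        have : 0 ≤ 2 * √(Real.log (1 / h)) * √(Real.log (1 / u)) := by positivity
        linarith
      have b4 : u ^ α ≤ 1 := Real.rpow_le_one hu0.le hu1 hα.le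
      have b5 := rpow_mul_sqrt_log_le hα hu0 hu1
      refine mul_le_mul_of_nonneg_left ?_ hD
      calc s ^ α * (1 + √(Real.log (1 / s)))
          ≤ s ^ α * (1 + (ℓ + √(Real.log (1 / u)))) := by gcongr
        _ = h ^ α * (u ^ α * (1 + ℓ) + u ^ α * √(Real.log (1 / u))) := by
            nth_rewrite 1 [es]
            rw [Real.mul_rpow hh.le hu0.le]; ring
        _ ≤ h ^ α * (1 * (1 + ℓ) + (1 + 1 / α)) := by gcongr
        _ = _ := by ring
    have b6 : |y (s + h) - y s| ≤ |y (s + h)| + |y s| := abs_sub _ _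
    have hp : 0 ≤ D * h ^ α := by positivity
    have b7 : 0 ≤ D * h ^ α * ℓ * (1 / α) := by positivity
    nlinarith

/-! ### Trading the logarithm for the growth in `p` -/

/-- The condition on `q` makes `(α - 1) q ≤ -2`, so the ranges `s ≤ h` and `s > h` each contribute
at most `h`. -/
theorem eLpNorm_min_one_rpow_le {α h q : ℝ} (hα1 : α < 1) (hh : 0 < h) (hq : 2 / (1 - α) ≤ q) :
    eLpNorm (fun s => min 1 ((s / h) ^ (α - 1))) (ENNReal.ofReal q)
      (volume.restrict (Ioo (0 : ℝ) 1)) ≤ ENNReal.ofReal ((2 * h) ^ (1 / q)) := by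
  have h1α : 0 < 1 - α := by linarith
  have hq0 : 0 < q := lt_of_lt_of_le (by positivity) hq
  rw [eLpNorm_eq_lintegral_rpow_enorm_toReal (by simpa using hq0) ENNReal.ofReal_ne_top,
    ENNReal.toReal_ofReal hq0.le, ← ENNReal.ofReal_rpow_of_nonneg (by positivity) (by positivity)]
  refine ENNReal.rpow_le_rpow ?_ (by positivity)
  have hpow : ∀ s : ℝ, 0 < s → ‖min 1 ((s / h) ^ (α - 1))‖ₑ ^ q =
      ENNReal.ofReal ((min 1 ((s / h) ^ (α - 1))) ^ q) := fun s hs => by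
    have : 0 ≤ min 1 ((s / h) ^ (α - 1)) := by positivity
    rw [Real.enorm_of_nonneg this, ENNReal.ofReal_rpow_of_nonneg this hq0.le]
  calc ∫⁻ s in Ioo (0 : ℝ) 1, ‖min 1 ((s / h) ^ (α - 1))‖ₑ ^ q
      ≤ ∫⁻ s in Ioc (0 : ℝ) h ∪ Ioi h, ‖min 1 ((s / h) ^ (α - 1))‖ₑ ^ q :=
        lintegral_mono_set fun s hs => by
          rcases le_or_gt s h with h' | h'
          · exact Or.inl ⟨hs.1, h'⟩
          · exact Or.inr h'
    _ ≤ (∫⁻ s in Ioc (0 : ℝ) h, ‖min 1 ((s / h) ^ (α - 1))‖ₑ ^ q) +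
        ∫⁻ s in Ioi h, ‖min 1 ((s / h) ^ (α - 1))‖ₑ ^ q := lintegral_union_le _ _ _
    _ ≤ ENNReal.ofReal h + ENNReal.ofReal h := by
        gcongr
        · calc ∫⁻ s in Ioc (0 : ℝ) h, ‖min 1 ((s / h) ^ (α - 1))‖ₑ ^ q
              ≤ ∫⁻ _ in Ioc (0 : ℝ) h, 1 := setLIntegral_mono measurable_const fun s hs => by
                have hs0 : 0 < s := hs.1
                rw [hpow s hs0, ENNReal.ofReal_le_one]
                exact Real.rpow_le_one (by positivity) (min_le_left _ _) hq0.le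
            _ = ENNReal.ofReal h := by simp
        · have hint : IntegrableOn (fun s : ℝ => h ^ 2 * s ^ (-2 : ℝ)) (Ioi h) :=
            (integrableOn_Ioi_rpow_of_lt (by norm_num) hh).const_mul _
          calc ∫⁻ s in Ioi h, ‖min 1 ((s / h) ^ (α - 1))‖ₑ ^ q
              ≤ ∫⁻ s in Ioi h, ENNReal.ofReal (h ^ 2 * s ^ (-2 : ℝ)) := by
                refine setLIntegral_mono (by fun_prop) fun s hs => ?_
                have hs0 : 0 < s := hh.trans hs
                have hsh : 1 ≤ s / h := (one_le_div hh).2 (le_of_lt hs)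
                rw [hpow s hs0]
                refine ENNReal.ofReal_le_ofReal ?_
                calc (min 1 ((s / h) ^ (α - 1))) ^ q ≤ ((s / h) ^ (α - 1)) ^ q := by
                      gcongr
                      exact min_le_right _ _
                  _ = (s / h) ^ ((α - 1) * q) := (Real.rpow_mul (by positivity) _ _).symm
                  _ ≤ (s / h) ^ (-2 : ℝ) := by
                      refine Real.rpow_le_rpow_of_exponent_le hsh ?_
                      have := (div_le_iff₀ h1α).1 hq
                      linarith
                  _ = h ^ 2 * s ^ (-2 : ℝ) := by
                      rw [Real.div_rpow hs0.le hh.le, Real.rpow_neg hh.le]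
                      norm_cast
                      field_simp
            _ = ENNReal.ofReal (∫ s in Ioi h, h ^ 2 * s ^ (-2 : ℝ)) :=
                (ofReal_integral_eq_lintegral_ofReal hint
                  ((ae_restrict_mem measurableSet_Ioi).mono fun s hs => by
                    have hs0 : 0 < s := hh.trans hs
                    positivity)).symm
            _ = ENNReal.ofReal h := by
                rw [integral_const_mul, integral_Ioi_rpow_of_lt (by norm_num) hh]
                congr 1
                norm_num
                rw [Real.rpow_neg_one]
                field_simp
    _ = ENNReal.ofReal (2 * h) := by rw [← ENNReal.ofReal_add hh.le hh.le, two_mul]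

/-- With `l = log(1/h)` and `q = max p p₀`, `h^{1/q} = exp(-l/q)`, hence `√l h^{1/q} ≤ √q ≤ √p₀ √p`;
the weight `p^{-1/2}` cancels `√p`. -/
theorem rpow_mul_one_add_sqrt_log_mul_rpow_le {h p p₀ : ℝ} (hh : 0 < h) (hh1 : h ≤ 1) (hp : 1 ≤ p)
    (hp₀ : 1 ≤ p₀) :
    p ^ (-1 / 2 : ℝ) * ((1 + √(Real.log (1 / h))) * (2 * h) ^ (1 / max p p₀)) ≤
      2 * (1 + √p₀) := by
  set q := max p p₀ with hqdef
  have hq1 : 1 ≤ q := hp.trans (le_max_left _ _)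
  have hq0 : 0 < q := by linarith
  have hl : 0 ≤ Real.log (1 / h) := Real.log_nonneg (by rw [le_div_iff₀ hh]; linarith)
  set l := Real.log (1 / h) with hldef
  have e1 : h ^ (1 / q) = Real.exp (-(l / q)) := by
    rw [Real.rpow_def_of_pos hh, hldef, one_div h, Real.log_inv]; congr 1; ring
  have h2q : (2 : ℝ) ^ (1 / q) ≤ 2 := by
    calc (2 : ℝ) ^ (1 / q) ≤ 2 ^ (1 : ℝ) :=
          Real.rpow_le_rpow_of_exponent_le (by norm_num) ((div_le_one hq0).2 hq1)
      _ = 2 := Real.rpow_one 2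
  have h3 : √l * Real.exp (-(l / q)) ≤ √q := by
    rw [Real.exp_neg, ← div_eq_mul_inv, div_le_iff₀ (Real.exp_pos _)]
    refine (Real.sqrt_le_left (by positivity)).2 ?_
    rw [mul_pow, Real.sq_sqrt hq0.le, ← Real.exp_nat_mul]
    have h4 := Real.add_one_le_exp (((2 : ℕ) : ℝ) * (l / q))
    have h5 : l = q * (l / q) := by field_simp
    have h6 : 0 ≤ l / q := by positivity
    push_cast at h4 ⊢
    nlinarith
  have h4 : Real.exp (-(l / q)) ≤ 1 := Real.exp_le_one_iff.2 (neg_nonpos.2 (by positivity))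
  have h5 : √q ≤ √p₀ * √p := by
    rw [← Real.sqrt_mul (by linarith)]
    refine Real.sqrt_le_sqrt (max_le ?_ ?_) <;> nlinarith
  have h6 : 1 ≤ √p := Real.one_le_sqrt.2 hp
  have h7 : p ^ (-1 / 2 : ℝ) * √p = 1 := by
    rw [Real.sqrt_eq_rpow, ← Real.rpow_add (by linarith)]; norm_num
  have h8 : 0 ≤ √p₀ := Real.sqrt_nonneg _
  calc p ^ (-1 / 2 : ℝ) * ((1 + √l) * (2 * h) ^ (1 / q))
      = p ^ (-1 / 2 : ℝ) *
        (2 ^ (1 / q) * (Real.exp (-(l / q)) + √l * Real.exp (-(l / q)))) := by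
        rw [Real.mul_rpow (by norm_num) hh.le, e1]; ring
    _ ≤ p ^ (-1 / 2 : ℝ) * (2 * (√p + √p₀ * √p)) := by
        have h9 := h3.trans h5
        have h10 : Real.exp (-(l / q)) ≤ √p := h4.trans h6
        have h11 : Real.exp (-(l / q)) + √l * Real.exp (-(l / q)) ≤ √p + √p₀ * √p :=
          add_le_add h10 h9
        exact mul_le_mul_of_nonneg_left (mul_le_mul h2q h11 (by positivity) (by norm_num))
          (by positivity)
    _ = 2 * (1 + √p₀) * (p ^ (-1 / 2 : ℝ) * √p) := by ring
    _ = 2 * (1 + √p₀) := by rw [h7, mul_one]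

/-! ### Membership in the Besov–Orlicz space -/

namespace BesovOrlicz

theorem measurableSet_incrementDomain (h : ℝ) : MeasurableSet (incrementDomain h) :=
  measurableSet_Ioo.inter ((measurable_add_const h) measurableSet_Ioo)

theorem expOrliczNorm_congr {β : ℝ} {A : Set ℝ} {f g : ℝ → ℝ}
    (h : f =ᵐ[volume.restrict A] g) : expOrliczNorm β A f = expOrliczNorm β A g := by
  unfold expOrliczNorm
  simp only [eLpNorm_congr_ae h]

/-- Translation by `h` carries `I(h)` onto `I(-h)` and flips the sign of the increment, so only
positive `h` need be treated. -/
theorem expOrliczNorm_neg_shift (β h : ℝ) (f : ℝ → ℝ) :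
    expOrliczNorm β (incrementDomain h) (fun s => f (s + h) - f s) =
      expOrliczNorm β (incrementDomain (-h)) (fun s => f (s + -h) - f s) := by
  have hpre : (fun s : ℝ => s + h) ⁻¹' incrementDomain (-h) = incrementDomain h := by
    ext s
    simp only [incrementDomain, mem_preimage, mem_ofPred_eq, add_neg_cancel_right]
    exact and_comm
  have he : MeasurableEmbedding fun s : ℝ => s + h := measurableEmbedding_addRight h
  have hmp := (measurePreserving_add_right (volume : Measure ℝ) h).restrict_preimage_emb he
    (incrementDomain (-h))
  rw [hpre] at hmp
  unfold expOrliczNorm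
  refine iSup_congr fun p => iSup_congr fun _ => ?_
  rw [← hmp.map_eq, he.eLpNorm_map_measure]
  congr 1
  rw [← eLpNorm_neg]
  congr 1
  funext s
  simp

theorem expOrliczNorm_increment_le {α H D : ℝ} (hα : 0 < α) (hα1 : α < 1) (hH1 : H < 1)
    (hD : 0 ≤ D) {y : ℝ → ℝ}
    (h1 : ∀ t ∈ Ioo (0 : ℝ) 1, |y t| ≤ D * (t ^ α * (1 + √(Real.log (1 / t)))))
    (h2 : ∀ s t : ℝ, 0 < s → s ≤ t → t < 1 → |y t - y s| ≤
      D * ((t ^ (2 * H) - s ^ (2 * H)) * s ^ (α - 2 * H) * (1 + √(Real.log (1 / s)))))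
    {h : ℝ} (hh : 0 < h) (hh1 : h ≤ 1) :
    expOrliczNorm 2 (incrementDomain h) (fun s => y (s + h) - y s) ≤
      ENNReal.ofReal (h ^ α * ((4 + 1 / α) * D * (2 * (1 + √(max 1 (2 / (1 - α))))))) := by
  set p₀ := max 1 (2 / (1 - α)) with hp₀
  refine iSup₂_le fun p hp => ?_
  have hp1 : (1 : ℝ) ≤ p := hp
  -- Small exponents are raised to `p₀`, past the threshold for tail integrability; on the
  -- probability space `(0, 1)` this only increases the norm.
  set q := max p p₀ with hq
  set ψ : ℝ → ℝ := fun s => min 1 ((s / h) ^ (α - 1)) with hψ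
  set M := (4 + 1 / α) * D * h ^ α * (1 + √(Real.log (1 / h))) with hM
  have hM0 : 0 ≤ M := by positivity
  have hψm : Measurable ψ := by fun_prop
  have : IsProbabilityMeasure (volume.restrict (Ioo (0 : ℝ) 1)) := ⟨by simp⟩
  have hle : eLpNorm (fun s => y (s + h) - y s) (ENNReal.ofReal p)
      (volume.restrict (incrementDomain h)) ≤ ENNReal.ofReal (M * (2 * h) ^ (1 / q)) := by
    calc eLpNorm (fun s => y (s + h) - y s) (ENNReal.ofReal p)
          (volume.restrict (incrementDomain h))
        ≤ eLpNorm (M • ψ) (ENNReal.ofReal p) (volume.restrict (incrementDomain h)) := by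
          refine eLpNorm_mono_ae_real ?_
          filter_upwards [ae_restrict_mem (measurableSet_incrementDomain h)] with s hs
          exact abs_increment_le hα hα1 hH1 hD h1 h2 hh hs.1.1 hs.2.2
      _ ≤ eLpNorm (M • ψ) (ENNReal.ofReal p) (volume.restrict (Ioo (0 : ℝ) 1)) :=
          eLpNorm_mono_measure _ (Measure.restrict_mono (fun s hs => hs.1) le_rfl)
      _ ≤ eLpNorm (M • ψ) (ENNReal.ofReal q) (volume.restrict (Ioo (0 : ℝ) 1)) :=
          eLpNorm_le_eLpNorm_of_exponent_le (ENNReal.ofReal_le_ofReal (le_max_left _ _))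
            (hψm.const_smul M).aestronglyMeasurable
      _ ≤ ENNReal.ofReal M * ENNReal.ofReal ((2 * h) ^ (1 / q)) := by
          rw [eLpNorm_const_smul, Real.enorm_of_nonneg hM0]
          gcongr
          exact eLpNorm_min_one_rpow_le hα1 hh ((le_max_right _ _).trans (le_max_right _ _))
      _ = ENNReal.ofReal (M * (2 * h) ^ (1 / q)) := (ENNReal.ofReal_mul hM0).symm
  refine (mul_le_mul_right hle _).trans ?_
  rw [← ENNReal.ofReal_mul (by positivity)]
  refine ENNReal.ofReal_le_ofReal ?_
  have key := rpow_mul_one_add_sqrt_log_mul_rpow_le hh hh1 hp1 (le_max_left 1 (2 / (1 - α)))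
  rw [← hp₀, ← hq] at key
  have hc : 0 ≤ h ^ α * ((4 + 1 / α) * D) := by positivity
  calc p ^ (-1 / 2 : ℝ) * (M * (2 * h) ^ (1 / q))
      = h ^ α * ((4 + 1 / α) * D) *
        (p ^ (-1 / 2 : ℝ) * ((1 + √(Real.log (1 / h))) * (2 * h) ^ (1 / q))) := by
        rw [hM]; ring
    _ ≤ h ^ α * ((4 + 1 / α) * D) * (2 * (1 + √p₀)) := mul_le_mul_of_nonneg_left key hc
    _ = _ := by ring

theorem expOrliczNorm_two_lt_top_of_bounded {f : ℝ → ℝ} {C : ℝ}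
    (h : ∀ᵐ t ∂volume.restrict (Ioo (0 : ℝ) 1), |f t| ≤ C) :
    expOrliczNorm 2 (Ioo 0 1) f < ∞ := by
  refine lt_of_le_of_lt (iSup₂_le fun p hp => ?_) (ENNReal.ofReal_lt_top (r := C))
  have hp1 : (1 : ℝ) ≤ p := hp
  have h1 : ENNReal.ofReal (p ^ (-1 / 2 : ℝ)) ≤ 1 :=
    ENNReal.ofReal_le_one.2 (Real.rpow_le_one_of_one_le_of_nonpos hp1 (by norm_num))
  have h2 := eLpNorm_le_of_ae_bound (f := f) (p := ENNReal.ofReal p)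
    (h.mono fun t ht => (Real.norm_eq_abs (f t)).trans_le ht)
  simp only [Measure.restrict_apply_univ, Real.volume_Ioo, sub_zero, ENNReal.ofReal_one,
    ENNReal.one_rpow, one_mul] at h2
  calc _ ≤ 1 * ENNReal.ofReal C := mul_le_mul' h1 h2
    _ = _ := one_mul _

theorem mem_space_of_bounds {α H D : ℝ} (hα : 0 < α) (hα1 : α < 1) (hH1 : H < 1)
    (hD : 0 ≤ D) {f y : ℝ → ℝ}
    (hf : AEStronglyMeasurable f (volume.restrict (Ioo (0 : ℝ) 1)))
    (hfy : f =ᵐ[volume.restrict (Ioo (0 : ℝ) 1)] y)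
    (h1 : ∀ t ∈ Ioo (0 : ℝ) 1, |y t| ≤ D * (t ^ α * (1 + √(Real.log (1 / t)))))
    (h2 : ∀ s t : ℝ, 0 < s → s ≤ t → t < 1 → |y t - y s| ≤
      D * ((t ^ (2 * H) - s ^ (2 * H)) * s ^ (α - 2 * H) * (1 + √(Real.log (1 / s))))) :
    f ∈ space α 2 := by
  refine ⟨hf, ?_, ?_⟩
  · refine expOrliczNorm_two_lt_top_of_bounded (C := D * (1 + (1 + 1 / α))) ?_
    filter_upwards [hfy, ae_restrict_mem measurableSet_Ioo] with t ht htI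
    rw [ht]
    refine (h1 t htI).trans (mul_le_mul_of_nonneg_left ?_ hD)
    have := rpow_mul_sqrt_log_le hα htI.1 htI.2.le
    have := Real.rpow_le_one htI.1.le htI.2.le hα.le
    linarith
  set C := (4 + 1 / α) * D * (2 * (1 + √(max 1 (2 / (1 - α))))) with hC
  have hC0 : 0 ≤ C := by positivity
  have hpos : ∀ h : ℝ, 0 < h → h ≤ 1 → expOrliczNorm 2 (incrementDomain h)
      (fun s => f (s + h) - f s) ≤ ENNReal.ofReal (h ^ α * C) := by
    intro h hh hh1
    refine (expOrliczNorm_congr ?_).trans_le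
      (expOrliczNorm_increment_le hα hα1 hH1 hD h1 h2 hh hh1)
    have hfy' := (ae_restrict_iff' measurableSet_Ioo).1 hfy
    have hshift : ∀ᵐ s : ℝ, s + h ∈ Ioo (0 : ℝ) 1 → f (s + h) = y (s + h) :=
      (measurePreserving_add_right volume h).quasiMeasurePreserving.ae hfy'
    refine (ae_restrict_iff' (measurableSet_incrementDomain h)).2 ?_
    filter_upwards [hfy', hshift] with s hs1 hs2 hs
    rw [hs1 hs.1, hs2 hs.2]
  have hall : ∀ h t : ℝ, |h| ≤ t → t ≤ 1 → expOrliczNorm 2 (incrementDomain h)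
      (fun s => f (s + h) - f s) ≤ ENNReal.ofReal (t ^ α * C) := by
    intro h t hht ht1
    have hmono : ∀ u : ℝ, 0 < u → u ≤ t →
        ENNReal.ofReal (u ^ α * C) ≤ ENNReal.ofReal (t ^ α * C) := fun u hu hut => by
      refine ENNReal.ofReal_le_ofReal ?_
      gcongr
    rcases lt_trichotomy h 0 with hneg | rfl | hh
    · rw [abs_of_neg hneg] at hht
      rw [expOrliczNorm_neg_shift]
      exact (hpos (-h) (by linarith) (by linarith)).trans (hmono _ (by linarith) hht)
    · simp [expOrliczNorm]
    · rw [abs_of_pos hh] at hht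
      exact (hpos h hh (by linarith)).trans (hmono _ hh hht)
  refine lt_of_le_of_lt (iSup₂_le fun t ht => ?_) (ENNReal.ofReal_lt_top (r := C))
  have hm : modulus 2 f t ≤ ENNReal.ofReal (t ^ α * C) := iSup₂_le fun h hh => hall h t hh ht.2
  refine (mul_le_mul_right hm _).trans_eq ?_
  have ht0 : 0 < t := ht.1
  rw [← ENNReal.ofReal_mul (by positivity), ← mul_assoc, ← Real.rpow_add ht0, neg_add_cancel,
    Real.rpow_zero, one_mul]

end BesovOrlicz

/-! ### Substituting `τ = t^{2H}` and conclusion -/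

theorem one_add_sqrt_log_one_div_rpow_le {H t : ℝ} (hH1 : H < 1) (ht : 0 < t) (ht1 : t < 1) :
    1 + √(Real.log (1 / t ^ (2 * H))) ≤ 2 * (1 + √(Real.log (1 / t))) := by
  have hl : 0 ≤ Real.log (1 / t) := Real.log_nonneg ((one_le_div ht).2 ht1.le)
  have h1 : √(Real.log (1 / t ^ (2 * H))) ≤ 2 * √(Real.log (1 / t)) := by
    refine (Real.sqrt_le_left (by positivity)).2 ?_
    rw [mul_pow, Real.sq_sqrt hl, one_div, one_div, Real.log_inv, Real.log_inv,
      Real.log_rpow ht]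
    rw [one_div, Real.log_inv] at hl
    nlinarith
  linarith

theorem mainTheorem1 {Ω : Type*} [MeasurableSpace Ω] (P : Measure Ω) [IsProbabilityMeasure P]
    (H K : ℝ) (hH : 0 < H) (hH' : H < 1) (hK : 0 < K) (hK' : K < 2) (hHK : H * K < 1)
    (W : ℝ≥0 → Ω → ℝ) (hW : IsBrownianReal W P)
    (X : ℝ≥0 → Ω → ℝ) (hX : IsLeiNualart H K W P X)
    (hXmeas : AEMeasurable (fun z : ℝ × Ω => X z.1.toNNReal z.2)
      ((volume.restrict (Ioo (0 : ℝ) 1)).prod P)) :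
    ∀ᵐ ω ∂P, (fun t : ℝ => X t.toNNReal ω) ∈ BesovOrlicz.space (H * K) 2 := by
  obtain ⟨B, hBm, hWB⟩ := exists_measurable_modification hW.aemeasurable hW.cont
  have hB : IsPreBrownianReal B P :=
    hW.toIsPreBrownianReal.congr fun t => hWB.mono fun ω hω => hω t
  -- the pathwise version obtained by integration by parts
  set Y : ℝ → Ω → ℝ := fun t ω =>
    ∫ θ in Ioi (0 : ℝ), leiNualartKernel K (t ^ (2 * H)) θ * B θ.toNNReal ω with hY
  have hYm : Measurable (Function.uncurry Y) := by
    have hm : Measurable fun p : (ℝ × Ω) × ℝ =>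
        leiNualartKernel K (p.1.1 ^ (2 * H)) p.2 * B p.2.toNNReal p.1.2 := by
      refine Measurable.mul ?_ ?_
      · exact (measurable_leiNualartKernel K).comp
          (((measurable_fst.comp measurable_fst).pow_const (2 * H)).prodMk measurable_snd)
      · exact hBm.comp ((measurable_real_toNNReal.comp measurable_snd).prodMk
          (measurable_snd.comp measurable_fst))
    exact hm.stronglyMeasurable.integral_prod_right'.measurable
  have hXY : ∀ t : ℝ, 0 < t → ∀ᵐ ω ∂P, X t.toNNReal ω = Y t ω := by
    intro t ht
    have hτ : 0 < t ^ (2 * H) := Real.rpow_pos_of_pos ht _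
    have h := hX.integral t.toNNReal (Real.toNNReal_pos.2 ht)
    rw [Real.coe_toNNReal _ ht.le] at h
    exact h.ae_eq_integral hB hBm hWB (measurable_leiNualartKernel K).of_uncurry_left
      (integrableOn_leiNualartKernel_mul_sqrt hK hK' hτ)
      (fun r hr => integrableOn_leiNualartKernel hK hτ hr)
      (fun r hr => integral_leiNualartKernel hK hτ hr)
  obtain ⟨X', hX'm, hXX'⟩ := hXmeas
  -- The exceptional null set in `hXY` depends on `t`. Joint measurability lets Fubini exchange the
  -- quantifiers: almost every path agrees with `Y` at almost every `t`.
  have hX'Y : ∀ᵐ z ∂(volume.restrict (Ioo (0 : ℝ) 1)).prod P, X' z = Y z.1 z.2 := by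
    have hms : MeasurableSet {z : ℝ × Ω | X' z = Y z.1 z.2} := measurableSet_eq_fun hX'm hYm
    rw [Measure.ae_prod_iff_ae_ae hms]
    filter_upwards [Measure.ae_ae_of_ae_prod hXX', ae_restrict_mem measurableSet_Ioo]
      with t ht htI
    filter_upwards [ht, hXY t htI.1] with ω h1 h2
    rw [← h1, h2]
  have hpath : ∀ᵐ ω ∂P, ∀ᵐ t ∂volume.restrict (Ioo (0 : ℝ) 1),
      X t.toNNReal ω = X' (t, ω) ∧ X' (t, ω) = Y t ω :=
    Measure.ae_ae_of_ae_prod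
      (Measure.measurePreserving_swap.quasiMeasurePreserving.ae (hXX'.and hX'Y))
  filter_upwards [hpath, hB.ae_integrableOn_mul_exp_sq_div hBm
    (m := fun θ : ℝ => θ ^ (-1 - K / 2) * min θ 1) (by fun_prop)
    (integrableOn_rpow_mul_min hK hK')] with ω hω hA
  obtain ⟨D, hD, hD1, hD2⟩ := exists_leiNualart_path_bounds hK hK'
    (hBm.of_uncurry_right.comp measurable_real_toNNReal) hA
  have hτ1 : ∀ t : ℝ, 0 < t → t < 1 → t ^ (2 * H) ≤ 1 := fun t ht ht1 =>
    Real.rpow_le_one ht.le ht1.le (by linarith)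
  -- The factor `2` in `D * 2` pays for replacing `log(1 / t^{2H})` by `log(1 / t)`.
  refine BesovOrlicz.mem_space_of_bounds (H := H) (D := D * 2) (mul_pos hH hK) hHK hH'
    (by linarith) (y := fun t => Y t ω) ?_ ?_ ?_ ?_
  · exact ⟨fun t => X' (t, ω), (hX'm.comp measurable_prodMk_right).stronglyMeasurable,
      hω.mono fun t ht => ht.1⟩
  · exact hω.mono fun t ht => ht.1.trans ht.2
  · intro t ht
    refine (hD1 _ (Real.rpow_pos_of_pos ht.1 _) (hτ1 t ht.1 ht.2)).trans ?_
    rw [mul_assoc D 2, ← Real.rpow_mul ht.1.le, show 2 * H * (K / 2) = H * K by ring,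
      mul_left_comm 2]
    have := one_add_sqrt_log_one_div_rpow_le hH' ht.1 ht.2
    have := Real.rpow_nonneg ht.1.le (H * K)
    gcongr
  · intro s t hs hst ht1
    have hst' : s ^ (2 * H) ≤ t ^ (2 * H) := Real.rpow_le_rpow hs.le hst (by linarith)
    refine (hD2 _ _ (Real.rpow_pos_of_pos hs _) hst' (hτ1 t (hs.trans_le hst) ht1)).trans ?_
    rw [mul_assoc D 2, ← Real.rpow_mul hs.le, show 2 * H * (K / 2 - 1) = H * K - 2 * H by ring,
      mul_left_comm 2]
    have := one_add_sqrt_log_one_div_rpow_le hH' hs (hst.trans_lt ht1)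
    have h0 : 0 ≤ (t ^ (2 * H) - s ^ (2 * H)) * s ^ (H * K - 2 * H) :=
      mul_nonneg (by linarith) (Real.rpow_nonneg hs.le _)
    gcongr
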